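/- **Setting.** Let $G$ be a group. A *$G$-tree* is a metric simplicial tree $T$ (an $\mathbb R$-tree whose set of non-regular points is closed and discrete, where $p$ is *regular* if $T\setminus\{p\}$ has exactly two components) with an isometric right action of $G$. Its vertex set $V(T)$ consists of the non-regular points together with the midpoints of the segments inverted by an element of $G$, and is required to be closed and discrete; its set of edges $E(T)$ consists of the arcs between two vertices which contain no other vertex. A *subforest* of $T$ is the union of a set of edges and a set of vertices containing the endpoints of these edges. $T$ is *minimal* if it has no proper $G$-invariant non-empty connected subforest, *cocompact* if $T/G$ is compact, and *edge-free* if every edge has trivial setwise stabiliser (a line without vertices, on which $G$ acts by translations, counts as edge-free if the translation lengths of the non-trivial elements of $G$ are bounded below by a positive number). A *free factor system* of $G$ is the set $\mathcal G_T$ of all subgroups of $G$ fixing a point of $T$, for some minimal, cocompact, edge-free $G$-tree $T$; it is *proper* if $G\notin\mathcal G_T$. For a free factor system $\mathcal G$, let $\mathcal O=\mathcal O(G,\mathcal G)$ be the space of minimal, cocompact, edge-free $G$-trees $T$ with $\mathcal G_T=\mathcal G$, up to $G$-equivariant isometry. Let $\alpha$ be an automorphism of $G$ with $\{\alpha(H):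 H\in\mathcal G\}=\mathcal G$, representing a class in $\mathrm{Out}(G,\mathcal G)$. It is *irreducible* if $\mathcal G$ is maximal, with respect to inclusion, among the proper $\alpha$-invariant free factor systems of $G$. For a $G$-tree $T$, let $\alpha T$ be the same metric tree with the action $x\cdot_\alpha g = x\cdot\alpha(g)$. With $l_T(g)=\inf_{x\in T} d_T(x,x\cdot g)$ put $$\Lambda_R(T,S)=\sup_g \frac{l_S(g)}{l_T(g)},\qquad \lambda_\alpha=\inf_{T\in\mathcal O}\Lambda_R(T,\alpha T),\qquad \mathrm{Min}(\alpha)=\{T\in\mathcal O:\Lambda_R(T,\alpha T)=\lambda_\alpha\},$$ where $g$ ranges over the elements of $G$ lying in no member of $\mathcal G$. **Theorem.** Let $\mathcal G$ be a free factor system for $G$ and let $\alpha\in\mathrm{Out}(G,\mathcal G)$ be irreducible with $\lambda_\alpha=1$. Let $T\in\mathrm{Min}(\alpha)$ and let $f:T\to\alpha T$ be a $G$-equivariant isometry. Then $f$ cyclically permutes the $G$-orbits of edges of $T$: $f$ maps edges of $T$ to edges of $T$, it induces a permutation $\varphi$ of the set $E(T)/G$ of $G$-orbits of (unoriented) edges,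 and the cyclic group $\langle\varphi\rangle$ acts transitively on $E(T)/G$. -/

import Mathlib

open scoped RightActions Pointwise ENNReal

universe u

/-! ### Metric simplicial trees -/

/-- `A` is an arc from `x` to `y`: the image of an injective path. -/
def IsArc {X : Type u} [TopologicalSpace X] (A : Set X) (x y : X) : Prop :=
  ∃ γ : C(unitInterval, X), Function.Injective γ ∧ γ 0 = x ∧ γ 1 = y ∧ Set.range γ = A

/-- An `ℝ`-tree: a non-empty metric space in which any two (distinct) points are joined by a unique
arc, and every arc is isometric to a closed interval of the real line. -/
structure IsRTree (X : Type u) [MetricSpace X] : Prop where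
  nonempty : Nonempty X
  unique_arc : ∀ x y : X, x ≠ y → ∃! A : Set X, IsArc A x y
  arc_isometric : ∀ (A : Set X) (x y : X), IsArc A x y →
    ∃ a b : ℝ, Nonempty (A ≃ᵢ Set.Icc a b)

/-- `p` is regular if the complement of `p` has exactly two components. -/
def IsRegularPoint {X : Type u} [TopologicalSpace X] (p : X) : Prop :=
  Nat.card (ConnectedComponents ↥({p}ᶜ : Set X)) = 2

/-- `S` is a discrete set of points: every point of the space has a ball in which it is the only
possible point of `S` (so `S` is closed and has the discrete topology). -/
def IsDiscreteIn {X : Type u} [MetricSpace X] (S : Set X) : Prop :=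
  ∀ x : X, ∃ ε > 0, ∀ s ∈ S, dist s x < ε → s = x

/-- A metric simplicial tree: an `ℝ`-tree whose set of non-regular points is discrete. -/
structure IsMetricSimplicialTree (X : Type u) [MetricSpace X] : Prop where
  isRTree : IsRTree X
  discrete : IsDiscreteIn {p : X | ¬ IsRegularPoint p}

/-- The vertex set given by a right action of `G`: all non-regular points, together with the
midpoints of all segments `[a, b]` that are inverted by an element of `G`.
(A regular point that is such a midpoint is the midpoint of an inverted edge of the structure
whose vertices are the non-regular points, or the centre of a reflection of a line.) -/
def vertexSet (G X : Type u) [Group G] [MetricSpace X] [MulAction Gᵐᵒᵖ X] : Set X :=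
  {x | ¬ IsRegularPoint x ∨ ∃ (g : G) (a b : X), a ≠ b ∧ a <• g = b ∧ b <• g = a ∧
    dist a x = dist a b / 2 ∧ dist x b = dist a b / 2}

/-! ### `G`-trees -/

/-- A `G`-tree: a metric simplicial tree with an isometric right action of `G`, for which the
vertex set above is discrete (automatic unless the tree is a line, in which case it excludes
groups of isometries of the line containing reflections and arbitrarily small translations). -/
structure GTree (G : Type u) [Group G] : Type (u + 1) where
  carrier : Type u
  [metric : MetricSpace carrier]
  [action : MulAction Gᵐᵒᵖ carrier]
  [isometric : IsIsometricSMul Gᵐᵒᵖ carrier]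
  isMetricSimplicialTree : IsMetricSimplicialTree carrier
  discrete_vertexSet : IsDiscreteIn (vertexSet G carrier)

namespace GTree

variable {G : Type u} [Group G]

instance : CoeSort (GTree G) (Type u) := ⟨GTree.carrier⟩

attribute [instance] GTree.metric GTree.action GTree.isometric

/-- The vertices of `T`. -/
def vertices (T : GTree G) : Set T := vertexSet G T

/-- The (closed, unoriented) edges of `T`: the arcs between two vertices which contain no other
vertex. -/
def edges (T : GTree G) : Set (Set T) :=
  {e | ∃ v ∈ T.vertices, ∃ w ∈ T.vertices, IsArc e v w ∧ e ∩ T.vertices = {v, w}}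

/-- Subforests: unions of a set `E'` of edges and a set `V'` of vertices containing the endpoints
of the edges in `E'`. -/
def IsSubforest (T : GTree G) (F : Set T) : Prop :=
  ∃ E' ⊆ T.edges, ∃ V' ⊆ T.vertices, (∀ e ∈ E', e ∩ T.vertices ⊆ V') ∧ F = V' ∪ ⋃₀ E'

/-- `T` has no proper `G`-invariant subtree (a subtree is a non-empty connected subforest). -/
def IsMinimal (T : GTree G) : Prop :=
  ∀ F : Set T, T.IsSubforest F → IsConnected F → (∀ g : G, F <• g = F) → F = Set.univ

/-- The quotient space `T / G` is compact. -/
def IsCocompact (T : GTree G) : Prop :=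
  CompactSpace (MulAction.orbitRel.Quotient Gᵐᵒᵖ T)

/-- Every edge has trivial (setwise) stabiliser. A cocompact `T` without vertices is a line on
which `G` acts by translations; this line has an invariant subdivision into edges with trivial
stabilisers exactly if the non-trivial elements of `G` have translation lengths bounded away
from `0`, which is what the second clause says. -/
structure IsEdgeFree (T : GTree G) : Prop where
  edge_stabilizer : ∀ e ∈ T.edges, ∀ g : G, e <• g = e → g = 1
  of_no_vertices : T.vertices = ∅ → ∃ ε > 0, ∀ g : G, g ≠ 1 → ∀ x : T, ε ≤ dist x (x <• g)

/-- The set of subgroups of `G` which fix a point of `T`. -/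
def ellipticSubgroups (T : GTree G) : Set (Subgroup G) :=
  {H | ∃ x : T, ∀ h ∈ H, x <• h = x}

/-- The translation length of `g` in `T`. -/
noncomputable def translationLength (T : GTree G) (g : G) : ℝ := ⨅ x : T, dist x (x <• g)

/-- The twisted tree `α T`: the same metric tree, on which `g` acts as `α g` acts on `T`. -/
def twist (α : MulAut G) (T : GTree G) : GTree G :=
  letI act : MulAction Gᵐᵒᵖ T.carrier := MulAction.compHom T.carrier α.toMonoidHom.op
  { carrier := T.carrier
    metric := T.metric
    action := act
    isometric := ⟨fun g => T.isometric.isometry_smul (α.toMonoidHom.op g)⟩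
    isMetricSimplicialTree := T.isMetricSimplicialTree
    discrete_vertexSet := by
      intro x
      obtain ⟨ε, hε, h⟩ := T.discrete_vertexSet x
      refine ⟨ε, hε, fun s hs => h s ?_⟩
      rcases hs with hs | ⟨g, a, b, hs⟩
      · exact Or.inl hs
      · exact Or.inr ⟨α g, a, b, hs⟩ }

/-- Two edges are equivalent if they lie in the same `G`-orbit. -/
def edgeSetoid (T : GTree G) : Setoid T.edges :=
  (MulAction.orbitRel Gᵐᵒᵖ (Set T)).comap Subtype.val

/-- The `G`-orbits of edges of `T`, i.e. the edges of the quotient graph `T / G`. -/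
def EdgeOrbit (T : GTree G) : Type u := Quotient T.edgeSetoid

/-- The `G`-orbit of an edge. -/
def edgeOrbit (T : GTree G) (e : T.edges) : T.EdgeOrbit := Quotient.mk T.edgeSetoid e

/-- A `G`-equivariant (bijective) isometry between `G`-trees. -/
structure EquivariantIsometry (T S : GTree G) extends T.carrier ≃ᵢ S.carrier where
  equivariant : ∀ (x : T) (g : G), toFun (x <• g) = toFun x <• g

end GTree

/-! ### Free factor systems, deformation spaces and irreducibility -/

section FreeFactorSystems

variable {G : Type u} [Group G]

/-- The minimal, cocompact, edge-free `G`-trees whose set of elliptic subgroups is `𝒢`; the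
deformation space is the set of these trees up to equivariant isometry. -/
def deformationSpace (𝒢 : Set (Subgroup G)) : Set (GTree G) :=
  {T | T.IsMinimal ∧ T.IsCocompact ∧ T.IsEdgeFree ∧ T.ellipticSubgroups = 𝒢}

/-- A free factor system is the set of elliptic subgroups of some minimal, cocompact, edge-free
`G`-tree. -/
def IsFreeFactorSystem (𝒢 : Set (Subgroup G)) : Prop :=
  ∃ T : GTree G, T.IsMinimal ∧ T.IsCocompact ∧ T.IsEdgeFree ∧ T.ellipticSubgroups = 𝒢

/-- `𝒢` is `α`-invariant: `{α(H) | H ∈ 𝒢} = 𝒢`. -/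
def IsInvariantUnder (𝒢 : Set (Subgroup G)) (α : MulAut G) : Prop :=
  (fun H : Subgroup G => H.map α.toMonoidHom) '' 𝒢 = 𝒢

/-- `α` is `𝒢`-irreducible: `𝒢` is maximal, with respect to inclusion, among the proper
`α`-invariant free factor systems of `G` (proper means that `G` itself is not a member). -/
def IsIrreducibleAut (𝒢 : Set (Subgroup G)) (α : MulAut G) : Prop :=
  Maximal (fun ℋ : Set (Subgroup G) =>
    IsFreeFactorSystem ℋ ∧ (⊤ : Subgroup G) ∉ ℋ ∧ IsInvariantUnder ℋ α) 𝒢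

/-! ### Stretching factors and displacement -/

/-- The elements of `G` which lie in no subgroup belonging to `𝒢`. -/
def hyperbolicElements (𝒢 : Set (Subgroup G)) : Set G := {g | ∀ H ∈ 𝒢, g ∉ H}

/-- The right stretching factor from `T` to `S`. -/
noncomputable def rightStretch (𝒢 : Set (Subgroup G)) (T S : GTree G) : ℝ≥0∞ :=
  ⨆ g ∈ hyperbolicElements 𝒢,
    ENNReal.ofReal (S.translationLength g) / ENNReal.ofReal (T.translationLength g)

/-- The displacement `λ_α`. -/
noncomputable def displacement (𝒢 : Set (Subgroup G)) (α : MulAut G) : ℝ≥0∞ :=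
  ⨅ T ∈ deformationSpace 𝒢, rightStretch 𝒢 T (T.twist α)

/-- The minimally displaced set `Min(α)`. -/
def minDisplaced (𝒢 : Set (Subgroup G)) (α : MulAut G) : Set (GTree G) :=
  {T | T ∈ deformationSpace 𝒢 ∧ rightStretch 𝒢 T (T.twist α) = displacement 𝒢 α}

end FreeFactorSystems

/-! Let `k` be the isometry of `T` underlying `f`, so that `k (x <• g) = k x <• α g`, and let `Γ` be
the group generated by `k` and the translations by elements of `G`. Translations fix every `G`-orbit
of edges and `k` acts on these orbits as `φ`, so it suffices that `Γ` is transitive on edges.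

Let `E` be a non-empty `Γ`-invariant set of edges. Collapsing all edges outside `E` gives a minimal,
cocompact, edge-free tree without global fixed point. Its elliptic subgroups form a proper
`α`-invariant free factor system containing `𝒢`, hence equal to `𝒢` by irreducibility. So the
stabiliser of a component of the union of the edges outside `E` fixes a point `p` of `T`
(`exists_fixed_point`). Up to this stabiliser the component has finitely many vertices, so some
vertex `v` is farthest from `p`, and `v` lies on only one edge outside `E`
(`exists_vertex_unique_edge`). The stabiliser of `v` preserves that edge and is therefore trivial,
and then minimality gives `v` valence at least three (`exists_three_edges`).

Suppose `Γ` is not transitive and fix an orbit `Γe`. Taking `E = Γe` yields a vertex `v` on exactly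
one edge `e'` outside `Γe` and on at least two edges of `Γe`. Taking for `E` the complement yields a
vertex `u` on exactly one edge of `Γe`. Hence `Γv` and `Γu` are disjoint and each edge of `Γe` joins
a point of `Γv` to a point of `Γu`. Sending it to the edge outside `Γe` at its end in `Γv` induces a
map from `Γe/G` onto `Γe'/G`. Two edges of `Γe` at `v` have the same image, but are not
`G`-equivalent because `v` has trivial stabiliser. So `Γe'` consists of fewer `G`-orbits than `Γe`
(`exists_orbitClasses_ncard_lt`), and since there are finitely many `G`-orbits of edges, infinite
descent gives a contradiction.

Trees are handled through betweenness: being an `ℝ`-tree is translated into the four point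
condition, which is easily checked for the collapsed metric, the length of the part of a segment
lying in `E`. -/

/-! ### Geodesic tree metrics -/

/-- The metric segment between two points. -/
def metricSegment {X : Type u} [PseudoMetricSpace X] (x y : X) : Set X :=
  {p | dist x p + dist p y = dist x y}

section Segment

variable {X : Type u} [PseudoMetricSpace X] {x y z w p q : X}

theorem mem_metricSegment : p ∈ metricSegment x y ↔ dist x p + dist p y = dist x y := Iff.rfl

theorem metricSegment_comm (x y : X) : metricSegment x y = metricSegment y x := by
  ext p
  rw [mem_metricSegment, mem_metricSegment, dist_comm x p, dist_comm p y, dist_comm x y, add_comm]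

theorem left_mem_metricSegment (x y : X) : x ∈ metricSegment x y := by simp [mem_metricSegment]

theorem right_mem_metricSegment (x y : X) : y ∈ metricSegment x y := by simp [mem_metricSegment]

theorem metricSegment_subset_left (hp : p ∈ metricSegment x y) :
    metricSegment x p ⊆ metricSegment x y := by
  intro q hq
  rw [mem_metricSegment] at *
  linarith [dist_triangle x q y, dist_triangle q p y]

theorem metricSegment_subset_right (hp : p ∈ metricSegment x y) :
    metricSegment p y ⊆ metricSegment x y := by
  rw [metricSegment_comm p y, metricSegment_comm x y] at *
  exact metricSegment_subset_left hp

theorem mem_metricSegment_of_left (hp : p ∈ metricSegment x y) (hq : q ∈ metricSegment x p) :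
    p ∈ metricSegment q y := by
  rw [mem_metricSegment] at *
  linarith [dist_triangle x q y, dist_triangle q p y]

theorem mem_metricSegment_of_right (hp : p ∈ metricSegment x y) (hq : q ∈ metricSegment p y) :
    p ∈ metricSegment x q := by
  rw [mem_metricSegment] at *
  linarith [dist_triangle x q y, dist_triangle x p q]

theorem isClosed_metricSegment (x y : X) : IsClosed (metricSegment x y) :=
  isClosed_eq (by fun_prop) (by fun_prop)

theorem IsometryEquiv.mem_metricSegment_iff {Y : Type u} [PseudoMetricSpace Y] (h : X ≃ᵢ Y) :
    h p ∈ metricSegment (h x) (h y) ↔ p ∈ metricSegment x y := by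
  simp only [mem_metricSegment, h.dist_eq]

theorem IsometryEquiv.image_metricSegment {Y : Type u} [PseudoMetricSpace Y] (h : X ≃ᵢ Y)
    (x y : X) : h '' metricSegment x y = metricSegment (h x) (h y) := by
  ext p
  obtain ⟨p, rfl⟩ := h.surjective p
  rw [h.mem_metricSegment_iff, h.injective.mem_set_image]

end Segment

theorem metricSegment_self {X : Type u} [MetricSpace X] (x : X) : metricSegment x x = {x} := by
  ext p
  rw [mem_metricSegment, dist_self, dist_comm p x, Set.mem_singleton_iff]
  constructor
  · intro h
    exact (dist_eq_zero.1 (by linarith : dist x p = 0)).symm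
  · rintro rfl
    simp

/-- A geodesic metric space satisfying the four point condition. -/
structure IsGeodesicTree (X : Type u) [MetricSpace X] : Prop where
  four_point : ∀ x y z w : X,
    dist x y + dist z w ≤ max (dist x z + dist y w) (dist x w + dist y z)
  exists_dist_eq : ∀ (x y : X) (s : ℝ), 0 ≤ s → s ≤ dist x y →
    ∃ p, dist x p = s ∧ dist p y = dist x y - s

namespace IsGeodesicTree

variable {X : Type u} [MetricSpace X] {x y z w p q m : X}

/-- The four point condition for `x, y, p, z`: each of the two possible maxima forces equality in
one triangle inequality. This tripod property replaces most arguments about branches below. -/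
theorem mem_or (h : IsGeodesicTree X) (hp : p ∈ metricSegment x y) (z : X) :
    p ∈ metricSegment x z ∨ p ∈ metricSegment y z := by
  simp only [mem_metricSegment] at *
  have h4 := h.four_point x y p z
  have h1 := dist_triangle x p z
  have h2 := dist_triangle y p z
  have h3 := dist_comm y p
  rcases le_max_iff.1 h4 with h5 | h5
  · right; linarith
  · left; linarith

theorem dist_eq_abs (h : IsGeodesicTree X) (hp : p ∈ metricSegment x y)
    (hq : q ∈ metricSegment x y) : dist p q = |dist x p - dist x q| := by
  simp only [mem_metricSegment] at *
  apply le_antisymm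
  · have h4 := h.four_point x y p q
    have h3 := dist_comm y p
    have h5 := dist_comm y q
    rcases le_max_iff.1 h4 with h6 | h6
    · linarith [le_abs_self (dist x p - dist x q)]
    · linarith [neg_abs_le (dist x p - dist x q)]
  · rw [dist_comm x p, dist_comm x q]
    exact abs_dist_sub_le p q x

theorem eq_of_dist_eq (h : IsGeodesicTree X) (hp : p ∈ metricSegment x y)
    (hq : q ∈ metricSegment x y) (e : dist x p = dist x q) : p = q := by
  rw [← dist_eq_zero, h.dist_eq_abs hp hq, e, sub_self, abs_zero]

theorem exists_median (h : IsGeodesicTree X) (x y z : X) :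
    ∃ m, m ∈ metricSegment x y ∧ m ∈ metricSegment x z ∧ m ∈ metricSegment y z := by
  have t1 := dist_triangle y x z
  have t2 := dist_triangle x y z
  have t3 := dist_triangle x z y
  have c1 := dist_comm y x
  have c2 := dist_comm z y
  -- The Gromov product of `y` and `z` at `x` is the distance from `x` to the centre of the tripod.
  obtain ⟨m, h1, h2⟩ := h.exists_dist_eq x y ((dist x y + dist x z - dist y z) / 2)
    (by linarith) (by linarith)
  have h4 := h.four_point x y z m
  have c3 := dist_comm z m
  have c4 := dist_comm y m
  have h5 : dist z m ≤ (dist x z + dist y z - dist x y) / 2 := by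
    rcases le_max_iff.1 h4 with h6 | h6 <;> linarith
  have t4 := dist_triangle x m z
  have t5 := dist_triangle y m z
  refine ⟨m, ?_, ?_, ?_⟩ <;> rw [mem_metricSegment] <;> linarith

theorem metricSegment_subset_union (h : IsGeodesicTree X) (x y z : X) :
    metricSegment x z ⊆ metricSegment x y ∪ metricSegment y z := by
  intro p hp
  rw [metricSegment_comm y z]
  exact h.mem_or hp y

theorem eq_of_mem_of_mem (hp : p ∈ metricSegment x y) (hq : y ∈ metricSegment x p) : p = y := by
  rw [mem_metricSegment] at *
  have := dist_comm y p
  exact dist_eq_zero.1 (by linarith [dist_nonneg (x := y) (y := p)])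

theorem apply_midpoint_eq (h : IsGeodesicTree X)
    (f : X ≃ᵢ X) {a b m : X} (h1 : f a = b) (h2 : f b = a) (h3 : dist a m = dist a b / 2)
    (h4 : dist m b = dist a b / 2) : f m = m := by
  have e1 := f.dist_eq a m
  have e2 := f.dist_eq m b
  rw [h1] at e1
  rw [h2] at e2
  have m1 : m ∈ metricSegment a b := by rw [mem_metricSegment]; linarith
  have m2 : f m ∈ metricSegment a b := by
    rw [mem_metricSegment, dist_comm a, dist_comm _ b]; linarith
  exact h.eq_of_dist_eq m2 m1 (by rw [dist_comm a]; linarith)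

/-- An isometric parametrisation of a segment. -/
theorem exists_param (h : IsGeodesicTree X) (x y : X) :
    ∃ σ : ℝ → X, (∀ s ∈ Set.Icc 0 (dist x y), ∀ t ∈ Set.Icc 0 (dist x y),
      dist (σ s) (σ t) = |s - t|) ∧ σ 0 = x ∧ σ (dist x y) = y ∧
      σ '' Set.Icc 0 (dist x y) = metricSegment x y := by
  have key : ∀ s : ℝ, ∃ p, s ∈ Set.Icc 0 (dist x y) → dist x p = s ∧ dist p y = dist x y - s := by
    intro s
    by_cases hs : s ∈ Set.Icc 0 (dist x y)
    · obtain ⟨p, hp⟩ := h.exists_dist_eq x y s hs.1 hs.2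
      exact ⟨p, fun _ => hp⟩
    · exact ⟨x, fun h => absurd h hs⟩
  choose σ hσ using key
  have hmem : ∀ s ∈ Set.Icc 0 (dist x y), σ s ∈ metricSegment x y := by
    intro s hs
    rw [mem_metricSegment, (hσ s hs).1, (hσ s hs).2]
    ring
  refine ⟨σ, ?_, ?_, ?_, ?_⟩
  · intro s hs t ht
    rw [h.dist_eq_abs (hmem s hs) (hmem t ht), (hσ s hs).1, (hσ t ht).1]
  · exact (dist_eq_zero.1 (hσ 0 ⟨le_rfl, dist_nonneg⟩).1).symm
  · have := (hσ (dist x y) ⟨dist_nonneg, le_rfl⟩).2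
    rw [sub_self] at this
    exact dist_eq_zero.1 this
  · apply Set.Subset.antisymm
    · rintro _ ⟨s, hs, rfl⟩
      exact hmem s hs
    · intro p hp
      have hs : dist x p ∈ Set.Icc 0 (dist x y) := by
        refine ⟨dist_nonneg, ?_⟩
        rw [mem_metricSegment] at hp
        linarith [dist_nonneg (x := p) (y := y)]
      exact ⟨dist x p, hs, h.eq_of_dist_eq (hmem _ hs) hp (hσ _ hs).1⟩

theorem continuousOn_of_dist_eq {σ : ℝ → X} {I : Set ℝ}
    (hσ : ∀ s ∈ I, ∀ t ∈ I, dist (σ s) (σ t) = |s - t|) : ContinuousOn σ I := by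
  have : LipschitzOnWith 1 σ I := LipschitzOnWith.of_dist_le_mul fun s hs t ht => by
    rw [hσ s hs t ht, Real.dist_eq, NNReal.coe_one, one_mul]
  exact this.continuousOn

/-! ### Segments as topological objects: compactness, connectedness, arcs -/

theorem isCompact_metricSegment (h : IsGeodesicTree X) (x y : X) :
    IsCompact (metricSegment x y) := by
  obtain ⟨σ, h1, -, -, h2⟩ := h.exists_param x y
  rw [← h2]
  exact isCompact_Icc.image_of_continuousOn (continuousOn_of_dist_eq h1)

theorem isPreconnected_metricSegment (h : IsGeodesicTree X) (x y : X) :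
    IsPreconnected (metricSegment x y) := by
  obtain ⟨σ, h1, -, -, h2⟩ := h.exists_param x y
  rw [← h2]
  exact isPreconnected_Icc.image _ (continuousOn_of_dist_eq h1)

/-- A point `p` of the segment missing from `S` would disconnect `S` into the points that `p`
separates from `x` and those that it does not. Both sets are open, the first because of `mem_or`. -/
theorem metricSegment_subset_of_isPreconnected (h : IsGeodesicTree X) {S : Set X}
    (hS : IsPreconnected S) (hx : x ∈ S) (hy : y ∈ S) : metricSegment x y ⊆ S := by
  intro p hp
  by_contra hpS
  have hxp : x ≠ p := fun e => hpS (e ▸ hx)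
  have hyp : y ≠ p := fun e => hpS (e ▸ hy)
  have ho1 : IsOpen {z | dist x z < dist x p + dist p z} :=
    isOpen_lt (by fun_prop) (by fun_prop)
  have ho2 : IsOpen {z | p ∈ metricSegment x z ∧ z ≠ p} := by
    rw [Metric.isOpen_iff]
    rintro z ⟨hz, hzp⟩
    refine ⟨dist z p, dist_pos.2 hzp, fun w hw => ?_⟩
    rw [Metric.mem_ball] at hw
    refine ⟨?_, ?_⟩
    · rcases h.mem_or hz w with h1 | h1
      · exact h1
      · exfalso
        rw [mem_metricSegment] at h1
        linarith [dist_comm w z, dist_nonneg (x := p) (y := w)]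
    · rintro rfl
      linarith [dist_comm w z]
  obtain ⟨z, -, hz1, hz2, -⟩ := hS _ _ ho1 ho2 (fun z hz => by
      by_cases hpz : p ∈ metricSegment x z
      · exact Or.inr ⟨hpz, fun e => hpS (e ▸ hz)⟩
      · exact Or.inl (lt_of_le_of_ne (dist_triangle _ _ _) (fun e => hpz e.symm)))
    ⟨x, hx, by
      have := dist_pos.2 hxp
      simp only [Set.mem_ofPred_eq, dist_self]
      linarith [dist_comm x p]⟩ ⟨y, hy, hp, hyp⟩
  rw [Set.mem_ofPred_eq] at hz1
  rw [mem_metricSegment] at hz2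
  linarith

theorem isArc_metricSegment (h : IsGeodesicTree X) (hxy : x ≠ y) :
    IsArc (metricSegment x y) x y := by
  obtain ⟨σ, h1, h0, hD, h2⟩ := h.exists_param x y
  have hpos := dist_pos.2 hxy
  have hmem : ∀ t : unitInterval, (t : ℝ) * dist x y ∈ Set.Icc 0 (dist x y) := fun t =>
    ⟨mul_nonneg t.2.1 hpos.le, mul_le_of_le_one_left hpos.le t.2.2⟩
  refine ⟨⟨fun t => σ (t * dist x y), (continuousOn_of_dist_eq h1).comp_continuous
    (by fun_prop) hmem⟩, ?_, by simpa using h0, by simpa using hD, ?_⟩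
  · intro s t hst
    have := h1 _ (hmem s) _ (hmem t)
    simp only [ContinuousMap.coe_mk] at hst
    rw [hst, dist_self, ← sub_mul, eq_comm, abs_eq_zero, mul_eq_zero] at this
    rcases this with h3 | h3
    · exact Subtype.ext (sub_eq_zero.1 h3)
    · exact absurd h3 hpos.ne'
  · rw [← h2]
    apply Set.Subset.antisymm
    · rintro _ ⟨t, rfl⟩
      exact ⟨_, hmem t, rfl⟩
    · rintro _ ⟨s, hs, rfl⟩
      refine ⟨⟨s / dist x y, div_nonneg hs.1 hpos.le, (div_le_one hpos).2 hs.2⟩, ?_⟩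
      simp [div_mul_cancel₀ _ hpos.ne']

theorem eq_metricSegment_of_isArc (h : IsGeodesicTree X) {A : Set X} (hA : IsArc A x y) :
    A = metricSegment x y := by
  obtain ⟨γ, hinj, rfl, rfl, rfl⟩ := hA
  have sub : ∀ s t : unitInterval, s ≤ t → metricSegment (γ s) (γ t) ⊆ γ '' Set.Icc s t :=
    fun s t hst => h.metricSegment_subset_of_isPreconnected
      (isPreconnected_Icc.image _ γ.continuous.continuousOn) ⟨s, ⟨le_rfl, hst⟩, rfl⟩
      ⟨t, ⟨hst, le_rfl⟩, rfl⟩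
  apply Set.Subset.antisymm
  · rintro _ ⟨t, rfl⟩
    -- The median lies on the image of `[0, t]` and on that of `[t, 1]`, so by injectivity it is `γ
    -- t`.
    obtain ⟨m, h1, h2, h3⟩ := h.exists_median (γ 0) (γ 1) (γ t)
    obtain ⟨a, ha, ha'⟩ := sub 0 t t.2.1 h2
    obtain ⟨b, hb, hb'⟩ := sub t 1 t.2.2 (by rw [metricSegment_comm]; exact h3)
    have hab : a = b := hinj (ha'.trans hb'.symm)
    have : t = a := le_antisymm (hab ▸ hb.1) ha.2
    rwa [this, ha']
  · exact (sub 0 1 zero_le_one).trans (Set.image_subset_range _ _)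

theorem isArc_iff (h : IsGeodesicTree X) {A : Set X} :
    IsArc A x y ↔ x ≠ y ∧ A = metricSegment x y := by
  constructor
  · intro hA
    refine ⟨?_, h.eq_metricSegment_of_isArc hA⟩
    obtain ⟨γ, hinj, rfl, rfl, rfl⟩ := hA
    exact fun e => zero_ne_one (hinj e)
  · rintro ⟨h1, rfl⟩
    exact h.isArc_metricSegment h1

/-- Needed for the collapsed tree, which is known only through its metric. -/
theorem isRTree (h : IsGeodesicTree X) [Nonempty X] : IsRTree X where
  nonempty := inferInstance
  unique_arc x y hxy := ⟨metricSegment x y, h.isArc_metricSegment hxy,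
    fun _ hA => h.eq_metricSegment_of_isArc hA⟩
  arc_isometric A x y hA := by
    obtain ⟨σ, h1, h0, hD, h2⟩ := h.exists_param x y
    obtain rfl := h.eq_metricSegment_of_isArc hA
    refine ⟨0, dist x y, ⟨IsometryEquiv.symm (IsometryEquiv.mk' (fun s => ⟨σ s, ?_⟩)
      (fun p => ⟨dist x p, dist_nonneg, ?_⟩) ?_ ?_)⟩⟩
    · rw [← h2]; exact ⟨s, s.2, rfl⟩
    · have := p.2
      rw [mem_metricSegment] at this
      linarith [dist_nonneg (x := (p : X)) (y := y)]
    · rintro ⟨p, hp⟩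
      obtain ⟨s, hs, rfl⟩ := h2 ▸ hp
      have := h1 0 ⟨le_rfl, dist_nonneg⟩ s hs
      rw [h0, zero_sub, abs_neg, abs_of_nonneg hs.1] at this
      simp [this]
    · refine Isometry.of_dist_eq fun s t => ?_
      exact h1 s s.2 t t.2

end IsGeodesicTree

/-! ### Regular points of geodesic trees -/

namespace IsGeodesicTree

variable {X : Type u} [MetricSpace X] {x y z w p q m : X}

theorem connectedComponents_eq_iff (h : IsGeodesicTree X) (z w : ({p}ᶜ : Set X)) :
    (z : ConnectedComponents ({p}ᶜ : Set X)) = w ↔ p ∉ metricSegment (z : X) w := by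
  rw [ConnectedComponents.coe_eq_coe']
  constructor
  · intro hz hp
    have h1 : IsPreconnected (Subtype.val '' connectedComponent w) :=
      isPreconnected_connectedComponent.image _ continuous_subtype_val.continuousOn
    obtain ⟨q, -, hq⟩ := h.metricSegment_subset_of_isPreconnected h1 ⟨z, hz, rfl⟩
      ⟨w, mem_connectedComponent, rfl⟩ hp
    exact q.2 hq
  · intro hp
    have h1 : IsPreconnected (Subtype.val ⁻¹' metricSegment (z : X) w : Set ({p}ᶜ : Set X)) := by
      rw [← Topology.IsInducing.subtypeVal.isPreconnected_image, Subtype.image_preimage_coe,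
        Set.inter_eq_right.2]
      · exact h.isPreconnected_metricSegment _ _
      · rintro q hq rfl
        exact hp hq
    exact h1.subset_connectedComponent (x := w) (right_mem_metricSegment (z : X) w)
      (left_mem_metricSegment (z : X) w)

/-- By `connectedComponents_eq_iff`, components of the complement of `p` are classes of points not
separated by `p`. Regularity thus becomes a statement about betweenness, which can be carried along
isometries and the collapse map. -/
theorem isRegularPoint_iff (h : IsGeodesicTree X) : IsRegularPoint p ↔
    ∃ a b, a ≠ p ∧ b ≠ p ∧ p ∈ metricSegment a b ∧
      ∀ z, z ≠ p → p ∉ metricSegment a z ∨ p ∉ metricSegment b z := by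
  rw [IsRegularPoint, Nat.card_eq_two_iff]
  constructor
  · rintro ⟨A, B, hAB, huniv⟩
    obtain ⟨a, rfl⟩ := ConnectedComponents.surjective_coe A
    obtain ⟨b, rfl⟩ := ConnectedComponents.surjective_coe B
    rw [Ne, h.connectedComponents_eq_iff, not_not] at hAB
    refine ⟨a, b, a.2, b.2, hAB, fun z hz => ?_⟩
    have : ((⟨z, hz⟩ : ({p}ᶜ : Set X)) : ConnectedComponents ({p}ᶜ : Set X)) ∈
        (Set.univ : Set (ConnectedComponents ({p}ᶜ : Set X))) := trivial
    rw [← huniv] at this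
    rcases this with h1 | h1
    · exact Or.inl ((h.connectedComponents_eq_iff _ _).1 h1.symm)
    · exact Or.inr ((h.connectedComponents_eq_iff _ _).1 (Eq.symm h1))
  · rintro ⟨a, b, ha, hb, hab, hall⟩
    refine ⟨((⟨a, ha⟩ : ({p}ᶜ : Set X)) : ConnectedComponents ({p}ᶜ : Set X)),
      ((⟨b, hb⟩ : ({p}ᶜ : Set X)) : ConnectedComponents ({p}ᶜ : Set X)), ?_, ?_⟩
    · rw [Ne, h.connectedComponents_eq_iff, not_not]
      exact hab
    · refine Set.eq_univ_of_forall fun Z => ?_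
      obtain ⟨z, rfl⟩ := ConnectedComponents.surjective_coe Z
      rcases hall z z.2 with h1 | h1
      · exact Or.inl ((h.connectedComponents_eq_iff _ _).2 h1).symm
      · exact Or.inr ((h.connectedComponents_eq_iff _ _).2 h1).symm

theorem not_isRegularPoint_of_three (h : IsGeodesicTree X) (hx : x ≠ p) (hy : y ≠ p) (hz : z ≠ p)
    (hxy : p ∈ metricSegment x y) (hxz : p ∈ metricSegment x z) (hyz : p ∈ metricSegment y z) :
    ¬ IsRegularPoint p := by
  rw [h.isRegularPoint_iff]
  rintro ⟨a, b, ha, hb, hab, hall⟩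
  -- Pigeonhole: of the three points, two lie on the same side of `p`, yet `p` separates them.
  have key : ∀ {u v c : X}, p ∈ metricSegment u v → p ∉ metricSegment c u →
      p ∉ metricSegment c v → False := by
    intro u v c huv hu hv
    rcases h.mem_or huv c with h1 | h1
    · exact hu (by rwa [metricSegment_comm])
    · exact hv (by rwa [metricSegment_comm])
  rcases hall x hx with h1 | h1 <;> rcases hall y hy with h2 | h2 <;>
    rcases hall z hz with h3 | h3
  all_goals first
    | exact key hxy h1 h2
    | exact key hxz h1 h3
    | exact key hyz h2 h3

theorem exists_third_direction (h : IsGeodesicTree X) (hp : ¬ IsRegularPoint p) (hx : x ≠ p)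
    (hy : y ≠ p) (hxy : p ∈ metricSegment x y) :
    ∃ z, z ≠ p ∧ p ∈ metricSegment x z ∧ p ∈ metricSegment y z := by
  by_contra! hcon
  exact hp (h.isRegularPoint_iff.2 ⟨x, y, hx, hy, hxy, fun z hz => by
    by_cases h1 : p ∈ metricSegment x z
    · exact Or.inr (hcon z hz h1)
    · exact Or.inl h1⟩)

theorem isRegularPoint_apply_iff {Y : Type u} [MetricSpace Y] (hX : IsGeodesicTree X)
    (hY : IsGeodesicTree Y) (f : X ≃ᵢ Y) : IsRegularPoint (f p) ↔ IsRegularPoint p := by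
  rw [hX.isRegularPoint_iff, hY.isRegularPoint_iff, f.surjective.exists]
  refine exists_congr fun a => ?_
  rw [f.surjective.exists]
  refine exists_congr fun b => ?_
  rw [f.surjective.forall]
  simp only [f.mem_metricSegment_iff, f.injective.ne_iff]

/-- A geodesic tree all of whose points are regular embeds isometrically in the line. -/
theorem exists_isometry_real (h : IsGeodesicTree X) (hreg : ∀ p : X, IsRegularPoint p) (o : X) :
    ∃ φ : X → ℝ, Isometry φ := by
  classical
  obtain ⟨a, b, ha, hb, hab, hall⟩ := h.isRegularPoint_iff.1 (hreg o)
  -- On one side of `o` the median of `o, z, w` must be `z` or `w`, as otherwise it would be a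
  -- branch point.
  have same : ∀ z w : X, o ∉ metricSegment z w → |dist o z - dist o w| = dist z w := by
    intro z w hzw
    obtain ⟨m, h1, h2, h3⟩ := h.exists_median o z w
    have hmo : m ≠ o := fun e => hzw (e ▸ h3)
    rcases eq_or_ne m z with rfl | hmz
    · rw [mem_metricSegment] at h2
      rw [abs_sub_comm, abs_of_nonneg] <;> linarith [dist_nonneg (x := m) (y := w)]
    rcases eq_or_ne m w with rfl | hmw
    · rw [mem_metricSegment] at h1
      rw [dist_comm z m, abs_of_nonneg] <;> linarith [dist_nonneg (x := m) (y := z)]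
    exact absurd (hreg m)
      (h.not_isRegularPoint_of_three hmo.symm hmz.symm hmw.symm h1 h2 h3)
  have diff : ∀ z w : X, o ∉ metricSegment a z → o ∈ metricSegment a w →
      dist z w = dist o z + dist o w := by
    intro z w hz hw
    rcases h.mem_or hw z with h1 | h1
    · exact absurd h1 hz
    · rw [mem_metricSegment] at h1
      rw [dist_comm z w, dist_comm o w]
      linarith
  -- The coordinate is the signed distance from `o`, positive on the side of `a`.
  refine ⟨fun z => if o ∈ metricSegment a z then - dist o z else dist o z,
    Isometry.of_dist_eq fun z w => ?_⟩
  rw [Real.dist_eq]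
  split_ifs with hz hw hw
  · rcases eq_or_ne z o with rfl | hzo
    · simp
    rcases eq_or_ne w o with rfl | hwo
    · simp [dist_comm]
    have hz' := (hall z hzo).resolve_left (not_not.2 hz)
    have hw' := (hall w hwo).resolve_left (not_not.2 hw)
    rw [← same z w, neg_sub_neg, abs_sub_comm]
    intro hzw
    rcases h.mem_or hzw b with h1 | h1
    · exact hz' (by rwa [metricSegment_comm])
    · exact hw' (by rwa [metricSegment_comm])
  · have h1 := diff w z hw hz
    rw [abs_sub_comm, sub_neg_eq_add, abs_of_nonneg (by positivity), dist_comm z w, h1]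
  · have h1 := diff z w hz hw
    rw [sub_neg_eq_add, abs_of_nonneg (by positivity), h1]
  · rw [same z w]
    intro hzw
    rcases h.mem_or hzw a with h1 | h1
    · exact hz (by rwa [metricSegment_comm])
    · exact hw (by rwa [metricSegment_comm])

/-- An isometry of a tree without branch points either moves all points by the same distance or is
a reflection. -/
theorem dist_apply_eq_or_reflection (h : IsGeodesicTree X) (hreg : ∀ p : X, IsRegularPoint p)
    (f : X ≃ᵢ X) : (∀ x y, dist x (f x) = dist y (f y)) ∨
      ∃ p a, a ≠ f a ∧ f (f a) = a ∧ dist a p = dist a (f a) / 2 ∧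
        dist p (f a) = dist a (f a) / 2 := by
  by_contra! hcon
  obtain ⟨⟨x, y, hxy⟩, hcon⟩ := hcon
  obtain ⟨φ, hφ⟩ := h.exists_isometry_real hreg x
  have hd : ∀ u v, dist u v = |φ u - φ v| := fun u v => by rw [← Real.dist_eq, hφ.dist_eq]
  have hf : ∀ u v, |φ (f u) - φ (f v)| = |φ u - φ v| := fun u v => by
    rw [← hd, ← hd, f.dist_eq]
  -- In the coordinate, `f` either preserves or reverses the displacement between `x` and `y`.
  -- Unequal displacements exclude the first case.
  have hsum : φ x + φ (f x) = φ y + φ (f y) := by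
    rw [hd, hd] at hxy
    rcases abs_eq_abs.1 (hf x y) with h1 | h1
    · exact absurd (by rw [show φ x - φ (f x) = φ y - φ (f y) by linarith]) hxy
    · linarith
  have hne : φ x ≠ φ y := fun e => hxy (by rw [hφ.injective e])
  -- The midpoint of `u` and `f u` is fixed, so `f` reflects in it. The auxiliary point `v` excludes
  -- that `f` moves the midpoint.
  have main : ∀ u v : X, φ u + φ (f u) = φ v + φ (f v) → u ≠ f u → φ u ≠ φ v → False := by
    intro u v huv hu huv'
    obtain ⟨p, hp1, hp2⟩ := h.exists_dist_eq u (f u) (dist u (f u) / 2) (by positivity)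
      (by linarith [dist_nonneg (x := u) (y := f u)])
    have hp2' : dist p (f u) = dist u (f u) / 2 := by rw [hp2]; ring
    have hu' : φ u ≠ φ (f u) := fun e => hu (hφ.injective e)
    have hmid : ∀ c A B : ℝ, A ≠ B → |A - c| = |A - B| / 2 → |c - B| = |A - B| / 2 →
        c = (A + B) / 2 := by
      intro c A B hAB h1 h2
      rcases abs_choice (A - c) with h3 | h3 <;> rcases abs_choice (c - B) with h4 | h4 <;>
        rcases abs_choice (A - B) with h5 | h5 <;> rw [h3, h5] at h1 <;> rw [h4, h5] at h2 <;>
        linarith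
    have hp : φ p = (φ u + φ (f u)) / 2 := by
      rw [hd, hd] at hp1 hp2'
      exact hmid _ _ _ hu' hp1 hp2'
    refine hcon p u hu ?_ hp1 hp2'
    have hfp : φ (f p) = φ p := by
      have e1 := hf p u
      have e2 := hf p v
      rcases abs_eq_abs.1 e1 with h1 | h1 <;> rcases abs_eq_abs.1 e2 with h2 | h2
      · exact absurd (by linarith) huv'
      · linarith
      · linarith
      · linarith
    apply hφ.injective
    rcases abs_eq_abs.1 (hf (f u) u) with h1 | h1 <;>
      rcases abs_eq_abs.1 (hf (f u) p) with h2 | h2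
    · exact absurd (by linarith) hu'
    · linarith
    · linarith
    · linarith
  by_cases hx : x = f x
  · refine main y x hsum.symm (fun e => hxy ?_) hne.symm
    rw [← hx, ← e, dist_self, dist_self]
  · exact main x y hsum hx hne

end IsGeodesicTree

/-! ### `ℝ`-trees are geodesic trees -/

namespace IsRTree

variable {X : Type u} [MetricSpace X]

/-- Composed with the isometry to a real interval, the parametrisation becomes an injective
continuous real function. It is therefore monotone, and betweenness is read off on the line. -/
theorem mem_metricSegment_of_mem_isArc (h : IsRTree X) {A : Set X} {x y p : X} (hA : IsArc A x y)
    (hp : p ∈ A) : p ∈ metricSegment x y := by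
  obtain ⟨a, b, ⟨φ⟩⟩ := h.arc_isometric A x y hA
  obtain ⟨γ, hinj, rfl, rfl, rfl⟩ := hA
  obtain ⟨t, rfl⟩ := hp
  set F : unitInterval → ℝ := fun s => φ ⟨γ s, s, rfl⟩ with hF
  have hd : ∀ s t, dist (γ s) (γ t) = |F s - F t| := fun s t => by
    rw [← Real.dist_eq]
    exact (φ.dist_eq ⟨γ s, s, rfl⟩ ⟨γ t, t, rfl⟩).symm
  have hc : Continuous F := by fun_prop
  have hi : Function.Injective F := fun s t e => by
    apply hinj
    rw [← dist_eq_zero, hd, e, sub_self, abs_zero]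
  rw [mem_metricSegment, hd, hd, hd]
  rcases hc.strictMono_of_inj_boundedOrder' hi with hm | hm
  · have h1 := hm.monotone (unitInterval.nonneg' (t := t))
    have h2 := hm.monotone (unitInterval.le_one' (t := t))
    change F 0 ≤ F t at h1
    change F t ≤ F 1 at h2
    rw [abs_of_nonpos, abs_of_nonpos, abs_of_nonpos] <;> linarith
  · have h1 := hm.antitone (unitInterval.nonneg' (t := t))
    have h2 := hm.antitone (unitInterval.le_one' (t := t))
    change F t ≤ F 0 at h1
    change F 1 ≤ F t at h2
    rw [abs_of_nonneg, abs_of_nonneg, abs_of_nonneg] <;> linarith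

theorem dist_eq_of_mem_isArc (h : IsRTree X) {A : Set X} {x y p q : X} (hA : IsArc A x y)
    (hp : p ∈ A) (hq : q ∈ A) : dist p q = |dist x p - dist x q| := by
  obtain ⟨a, b, ⟨φ⟩⟩ := h.arc_isometric A x y hA
  obtain ⟨γ, hinj, rfl, rfl, rfl⟩ := hA
  obtain ⟨t, rfl⟩ := hp
  obtain ⟨s, rfl⟩ := hq
  set F : unitInterval → ℝ := fun s => φ ⟨γ s, s, rfl⟩ with hF
  have hd : ∀ s t, dist (γ s) (γ t) = |F s - F t| := fun s t => by
    rw [← Real.dist_eq]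
    exact (φ.dist_eq ⟨γ s, s, rfl⟩ ⟨γ t, t, rfl⟩).symm
  have hc : Continuous F := by fun_prop
  have hi : Function.Injective F := fun s t e => by
    apply hinj
    rw [← dist_eq_zero, hd, e, sub_self, abs_zero]
  rw [hd, hd, hd]
  rcases hc.strictMono_of_inj_boundedOrder' hi with hm | hm
  · have h1 := hm.monotone (unitInterval.nonneg' (t := t))
    have h2 := hm.monotone (unitInterval.nonneg' (t := s))
    change F 0 ≤ F t at h1
    change F 0 ≤ F s at h2
    rw [abs_of_nonpos (a := F 0 - F t) (by linarith),
      abs_of_nonpos (a := F 0 - F s) (by linarith)]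
    congr 1; ring
  · have h1 := hm.antitone (unitInterval.nonneg' (t := t))
    have h2 := hm.antitone (unitInterval.nonneg' (t := s))
    change F t ≤ F 0 at h1
    change F s ≤ F 0 at h2
    rw [abs_of_nonneg (a := F 0 - F t) (by linarith),
      abs_of_nonneg (a := F 0 - F s) (by linarith), ← abs_neg]
    congr 1; ring

theorem exists_param (h : IsRTree X) (x y : X) :
    ∃ σ : ℝ → X, Continuous σ ∧ (∀ s ∈ Set.Icc 0 (dist x y), ∀ t ∈ Set.Icc 0 (dist x y),
      dist (σ s) (σ t) = |s - t|) ∧ σ 0 = x ∧ σ (dist x y) = y := by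
  rcases eq_or_ne x y with rfl | hxy
  · refine ⟨fun _ => x, continuous_const, ?_, rfl, rfl⟩
    rw [dist_self, Set.Icc_self]
    rintro _ rfl _ rfl
    simp
  obtain ⟨A, hA, -⟩ := h.unique_arc x y hxy
  have hex : ∀ s : Set.Icc 0 (dist x y), ∃ p ∈ A, dist x p = s := by
    obtain ⟨γ, hinj, rfl, rfl, rfl⟩ := hA
    rintro ⟨s, hs⟩
    have hc : Continuous fun t => dist (γ 0) (γ t) := by fun_prop
    obtain ⟨t, ht⟩ := intermediate_value_univ 0 1 hc ⟨by simpa using hs.1, hs.2⟩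
    exact ⟨γ t, ⟨t, rfl⟩, ht⟩
  choose σ hσA hσ using hex
  have hiso : ∀ s t, dist (σ s) (σ t) = |(s : ℝ) - t| := fun s t => by
    rw [h.dist_eq_of_mem_isArc hA (hσA s) (hσA t), hσ, hσ]
  have hI : Isometry σ := Isometry.of_dist_eq fun s t => by
    rw [hiso, Subtype.dist_eq, Real.dist_eq]
  have h0 : (0 : ℝ) ≤ dist x y := dist_nonneg
  refine ⟨Set.IccExtend h0 σ, hI.continuous.Icc_extend', ?_, ?_, ?_⟩
  · intro s hs t ht
    rw [Set.IccExtend_of_mem _ _ hs, Set.IccExtend_of_mem _ _ ht, hiso]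
  · rw [Set.IccExtend_left]
    exact (dist_eq_zero.1 (hσ ⟨0, _⟩)).symm
  · rw [Set.IccExtend_right]
    have hy := h.mem_metricSegment_of_mem_isArc hA (hσA ⟨dist x y, ⟨h0, le_rfl⟩⟩)
    rw [mem_metricSegment, hσ] at hy
    exact dist_eq_zero.1 (by linarith)

theorem mem_metricSegment_of_injOn (h : IsRTree X) {ρ : ℝ → X} {L t : ℝ} (hc : Continuous ρ)
    (hi : Set.InjOn ρ (Set.Icc 0 L)) (ht : t ∈ Set.Icc 0 L) :
    ρ t ∈ metricSegment (ρ 0) (ρ L) := by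
  rcases (ht.1.trans ht.2).eq_or_lt with rfl | hL
  · rw [le_antisymm ht.2 ht.1]
    exact left_mem_metricSegment _ _
  have hmem : ∀ s : unitInterval, (s : ℝ) * L ∈ Set.Icc 0 L := fun s =>
    ⟨mul_nonneg s.2.1 hL.le, mul_le_of_le_one_left hL.le s.2.2⟩
  refine h.mem_metricSegment_of_mem_isArc
    (A := Set.range fun s : unitInterval => ρ (s * L))
    ⟨⟨fun s => ρ (s * L), by fun_prop⟩, ?_, by simp, by simp, rfl⟩
    ⟨⟨t / L, div_nonneg ht.1 hL.le, (div_le_one hL).2 ht.2⟩, ?_⟩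
  · intro s s' hs
    exact Subtype.ext (mul_right_cancel₀ hL.ne' (hi (hmem s) (hmem s') hs))
  · simp [div_mul_cancel₀ _ hL.ne']

theorem exists_median_on_param (h : IsRTree X) {x y : X} {σ : ℝ → X} (hc : Continuous σ)
    (hσ : ∀ s ∈ Set.Icc 0 (dist x y), ∀ t ∈ Set.Icc 0 (dist x y), dist (σ s) (σ t) = |s - t|)
    (h0 : σ 0 = x) (hD : σ (dist x y) = y) (z : X) :
    ∃ s ∈ Set.Icc 0 (dist x y), σ s ∈ metricSegment x z ∧ σ s ∈ metricSegment y z := by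
  obtain ⟨τ, hτc, hτ, hτ0, hτD⟩ := h.exists_param x z
  have hdσ : ∀ s ∈ Set.Icc 0 (dist x y), dist x (σ s) = s := fun s hs => by
    have := hσ 0 ⟨le_rfl, dist_nonneg⟩ s hs
    rwa [h0, zero_sub, abs_neg, abs_of_nonneg hs.1] at this
  have hdτ : ∀ s ∈ Set.Icc 0 (dist x z), dist x (τ s) = s := fun s hs => by
    have := hτ 0 ⟨le_rfl, dist_nonneg⟩ s hs
    rwa [hτ0, zero_sub, abs_neg, abs_of_nonneg hs.1] at this
  -- The branch point is the last point of `[x, y]` that also lies on `[x, z]`.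
  have hK : IsCompact (Set.Icc 0 (dist x y) ∩ σ ⁻¹' (τ '' Set.Icc 0 (dist x z))) :=
    isCompact_Icc.inter_right ((isCompact_Icc.image hτc).isClosed.preimage hc)
  obtain ⟨s, ⟨hs, s', hs', hss⟩, hmax⟩ := hK.exists_isGreatest
    ⟨0, ⟨le_rfl, dist_nonneg⟩, 0, ⟨le_rfl, dist_nonneg⟩, by rw [h0, hτ0]⟩
  obtain rfl : s' = s := by rw [← hdτ s' hs', ← hdσ s hs, hss]
  refine ⟨s', hs, ?_, ?_⟩
  · rw [mem_metricSegment, hdσ s' hs, ← hss]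
    have e := hτ s' hs' _ ⟨dist_nonneg, le_rfl⟩
    rw [hτD, abs_sub_comm, abs_of_nonneg (by linarith [hs'.2])] at e
    rw [e]
    ring
  · set c := dist x y - s' with hcdef
    set L := c + (dist x z - s') with hL
    -- Walk from `y` back to the branch point and on to `z`. By maximality the path is injective,
    -- hence an arc, hence geodesic.
    set ρ : ℝ → X := fun t => if t ≤ c then σ (dist x y - t) else τ (s' + (t - c)) with hρ
    have hρc : Continuous ρ := by
      refine Continuous.if_le (by fun_prop) (by fun_prop) continuous_id continuous_const ?_
      rintro t rfl
      rw [hcdef, sub_sub_cancel, sub_self, add_zero, hss]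
    have e0 : ρ 0 = y := by
      rw [hρ]
      simp only [sub_zero]
      rw [if_pos (by linarith [hs.2]), hD]
    have eL : ρ L = z := by
      rw [hρ]
      simp only []
      split_ifs with h1
      · have : dist x z = s' := by linarith [hs'.2]
        rw [show dist x y - L = s' by linarith, ← hss]
        nth_rw 1 [← this]
        exact hτD
      · rw [show s' + (L - c) = dist x z by rw [hL]; ring]
        exact hτD
    have ec : ρ c = σ s' := by
      rw [hρ]
      simp only [le_refl, if_true]
      rw [hcdef, sub_sub_cancel]
    have hcross : ∀ t t', 0 ≤ t → t ≤ c → c < t' → t' ≤ L →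
        σ (dist x y - t) ≠ τ (s' + (t' - c)) := by
      intro t t' h1 h2 h3 h4 he
      have m1 : dist x y - t ∈ Set.Icc 0 (dist x y) := ⟨by linarith [hs.1], by linarith⟩
      have m2 : s' + (t' - c) ∈ Set.Icc 0 (dist x z) := ⟨by linarith [hs.1], by linarith⟩
      have := hmax ⟨m1, _, m2, he.symm⟩
      have e1 := hdσ _ m1
      rw [he, hdτ _ m2] at e1
      linarith
    have hinj : Set.InjOn ρ (Set.Icc 0 L) := by
      intro t ht t' ht' he
      rw [hρ] at he
      simp only [] at he
      split_ifs at he with h1 h2 h2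
      · have m1 : dist x y - t ∈ Set.Icc 0 (dist x y) := ⟨by linarith [hs.1], by linarith [ht.1]⟩
        have m2 : dist x y - t' ∈ Set.Icc 0 (dist x y) :=
          ⟨by linarith [hs.1], by linarith [ht'.1]⟩
        have := hdσ _ m1
        rw [he, hdσ _ m2] at this
        linarith
      · exact absurd he (hcross t t' ht.1 h1 (not_le.1 h2) ht'.2)
      · exact absurd he.symm (hcross t' t ht'.1 h2 (not_le.1 h1) ht.2)
      · have m1 : s' + (t - c) ∈ Set.Icc 0 (dist x z) :=
          ⟨by linarith [hs.1, not_le.1 h1], by linarith [ht.2]⟩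
        have m2 : s' + (t' - c) ∈ Set.Icc 0 (dist x z) :=
          ⟨by linarith [hs.1, not_le.1 h2], by linarith [ht'.2]⟩
        have := hdτ _ m1
        rw [he, hdτ _ m2] at this
        linarith
    have := h.mem_metricSegment_of_injOn hρc hinj (t := c)
      ⟨by linarith [hs.2], by linarith [hs'.2]⟩
    rwa [ec, e0, eL] at this

theorem isGeodesicTree (h : IsRTree X) : IsGeodesicTree X where
  exists_dist_eq x y s h1 h2 := by
    obtain ⟨σ, -, hσ, h0, hD⟩ := h.exists_param x y
    have e1 := hσ 0 ⟨le_rfl, dist_nonneg⟩ s ⟨h1, h2⟩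
    have e2 := hσ s ⟨h1, h2⟩ _ ⟨dist_nonneg, le_rfl⟩
    rw [h0, zero_sub, abs_neg, abs_of_nonneg h1] at e1
    rw [hD, abs_sub_comm, abs_of_nonneg (by linarith)] at e2
    exact ⟨σ s, e1, e2⟩
  four_point x y z w := by
    obtain ⟨σ, hc, hσ, h0, hD⟩ := h.exists_param x y
    obtain ⟨s, hs, hs1, hs2⟩ := h.exists_median_on_param hc hσ h0 hD z
    obtain ⟨t, ht, ht1, ht2⟩ := h.exists_median_on_param hc hσ h0 hD w
    have hd : ∀ r ∈ Set.Icc 0 (dist x y), dist x (σ r) = r ∧ dist y (σ r) = dist x y - r := by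
      intro r hr
      have e1 := hσ 0 ⟨le_rfl, dist_nonneg⟩ r hr
      have e2 := hσ _ ⟨dist_nonneg, le_rfl⟩ r hr
      rw [h0, zero_sub, abs_neg, abs_of_nonneg hr.1] at e1
      rw [hD, abs_of_nonneg (by linarith [hr.2])] at e2
      exact ⟨e1, e2⟩
    rw [mem_metricSegment] at hs1 hs2 ht1 ht2
    have e3 := hσ s hs t ht
    have t1 := dist_triangle z (σ s) w
    have t2 := dist_triangle (σ s) (σ t) w
    have c1 := dist_comm z (σ s)
    obtain ⟨a1, a2⟩ := hd s hs
    obtain ⟨b1, b2⟩ := hd t ht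
    -- The order in which `z` and `w` branch off `[x, y]` decides which pairing bounds the sum.
    rcases le_total s t with hst | hst
    · rw [abs_sub_comm, abs_of_nonneg (by linarith)] at e3
      exact le_max_of_le_right (by linarith)
    · rw [abs_of_nonneg (by linarith)] at e3
      exact le_max_of_le_left (by linarith)

end IsRTree

/-! ### Discrete sets -/

namespace IsDiscreteIn

variable {X : Type u} [MetricSpace X] {S : Set X}

theorem isClosed (h : IsDiscreteIn S) : IsClosed S := by
  rw [← isOpen_compl_iff, Metric.isOpen_iff]
  intro x hx
  obtain ⟨ε, hε, hs⟩ := h x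
  exact ⟨ε, hε, fun y hy hyS => hx (hs y hyS hy ▸ hyS)⟩

theorem finite_inter (h : IsDiscreteIn S) {K : Set X} (hK : IsCompact K) : (K ∩ S).Finite := by
  choose ε hε hs using h
  obtain ⟨t, -, ht⟩ := hK.elim_nhds_subcover (fun x => Metric.ball x (ε x))
    (fun x _ => Metric.ball_mem_nhds x (hε x))
  refine t.finite_toSet.subset ?_
  rintro y ⟨hyK, hyS⟩
  obtain ⟨x, hx, hyx⟩ := Set.mem_iUnion₂.1 (ht hyK)
  rw [hs x y hyS hyx]
  exact hx

end IsDiscreteIn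

namespace GTree

variable {G : Type u} [Group G]

/-! ### Symmetries -/

theorem isGeodesicTree (T : GTree G) : IsGeodesicTree T :=
  T.isMetricSimplicialTree.isRTree.isGeodesicTree

instance (T : GTree G) : Nonempty T := T.isMetricSimplicialTree.isRTree.nonempty

/-- The isometry given by the action of a group element. -/
def translation (T : GTree G) (g : G) : T ≃ᵢ T := IsometryEquiv.constSMul (MulOpposite.op g)

theorem translation_apply (T : GTree G) (g : G) (x : T) : T.translation g x = x <• g := rfl

theorem image_translation (T : GTree G) (g : G) (A : Set T) : T.translation g '' A = A <• g := rfl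

/-- Isometries which are equivariant with respect to an automorphism of the group. -/
def IsSymmetry (T : GTree G) (h : T ≃ᵢ T) : Prop :=
  ∃ β : MulAut G, ∀ (x : T) (g : G), h (x <• g) = h x <• β g

variable {T : GTree G}

theorem smul_smul_eq (x : T) (g k : G) : x <• g <• k = x <• (g * k) := by
  rw [smul_smul, MulOpposite.op_mul]

theorem smul_one_eq (x : T) : x <• (1 : G) = x := by
  rw [MulOpposite.op_one, one_smul]

theorem smul_inv_smul_eq (x : T) (g : G) : x <• g <• g⁻¹ = x := by
  rw [smul_smul_eq, mul_inv_cancel, smul_one_eq]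

theorem inv_smul_smul_eq (x : T) (g : G) : x <• g⁻¹ <• g = x := by
  rw [smul_smul_eq, inv_mul_cancel, smul_one_eq]

theorem dist_smul_eq (x y : T) (g : G) : dist (x <• g) (y <• g) = dist x y := dist_smul _ _ _

theorem isSymmetry_translation (T : GTree G) (g : G) : T.IsSymmetry (T.translation g) := by
  refine ⟨MulAut.conj g⁻¹, fun x k => ?_⟩
  simp only [translation_apply, smul_smul_eq, MulAut.conj_apply]
  congr 2
  group

theorem IsSymmetry.symm {h : T ≃ᵢ T} (hh : T.IsSymmetry h) : T.IsSymmetry h.symm := by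
  obtain ⟨β, hβ⟩ := hh
  refine ⟨β⁻¹, fun x g => ?_⟩
  rw [h.symm_apply_eq, hβ, h.apply_symm_apply]
  simp

theorem IsSymmetry.mul {h k : T ≃ᵢ T} (hh : T.IsSymmetry h) (hk : T.IsSymmetry k) :
    T.IsSymmetry (h * k) := by
  obtain ⟨β, hβ⟩ := hh
  obtain ⟨β', hβ'⟩ := hk
  exact ⟨β * β', fun x g => by simp [hβ, hβ']⟩

theorem IsSymmetry.apply_mem_vertices {h : T ≃ᵢ T} (hh : T.IsSymmetry h) {x : T}
    (hx : x ∈ T.vertices) : h x ∈ T.vertices := by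
  obtain ⟨β, hβ⟩ := hh
  rcases hx with hx | ⟨g, a, b, hab, h1, h2, h3, h4⟩
  · left
    rwa [T.isGeodesicTree.isRegularPoint_apply_iff T.isGeodesicTree]
  · right
    refine ⟨β g, h a, h b, h.injective.ne hab, ?_, ?_, ?_, ?_⟩
    · rw [← hβ, h1]
    · rw [← hβ, h2]
    · rw [h.dist_eq, h.dist_eq, h3]
    · rw [h.dist_eq, h.dist_eq, h4]

theorem IsSymmetry.apply_mem_vertices_iff {h : T ≃ᵢ T} (hh : T.IsSymmetry h) {x : T} :
    h x ∈ T.vertices ↔ x ∈ T.vertices := by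
  refine ⟨fun hx => ?_, hh.apply_mem_vertices⟩
  rw [← h.symm_apply_apply x]
  exact hh.symm.apply_mem_vertices hx

/-- `v` and `w` are the endpoints of an edge. -/
structure IsEdge (T : GTree G) (v w : T) : Prop where
  left_mem : v ∈ T.vertices
  right_mem : w ∈ T.vertices
  ne : v ≠ w
  eq_or_eq : ∀ u ∈ metricSegment v w, u ∈ T.vertices → u = v ∨ u = w

theorem IsEdge.symm {v w : T} (h : T.IsEdge v w) : T.IsEdge w v where
  left_mem := h.right_mem
  right_mem := h.left_mem
  ne := h.ne.symm
  eq_or_eq u hu hu' := (h.eq_or_eq u (by rwa [metricSegment_comm]) hu').symm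

theorem mem_edges_iff {e : Set T} : e ∈ T.edges ↔ ∃ v w, T.IsEdge v w ∧ e = metricSegment v w := by
  constructor
  · rintro ⟨v, hv, w, hw, hA, hV⟩
    obtain ⟨hne, rfl⟩ := T.isGeodesicTree.isArc_iff.1 hA
    exact ⟨v, w, ⟨hv, hw, hne, fun u hu hu' => hV.subset ⟨hu, hu'⟩⟩, rfl⟩
  · rintro ⟨v, w, h, rfl⟩
    refine ⟨v, h.left_mem, w, h.right_mem, T.isGeodesicTree.isArc_metricSegment h.ne, ?_⟩
    apply Set.Subset.antisymm
    · exact fun u hu => h.eq_or_eq u hu.1 hu.2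
    · rintro u (rfl | rfl)
      · exact ⟨left_mem_metricSegment _ _, h.left_mem⟩
      · exact ⟨right_mem_metricSegment _ _, h.right_mem⟩

theorem IsEdge.mem_edges {v w : T} (h : T.IsEdge v w) : metricSegment v w ∈ T.edges :=
  mem_edges_iff.2 ⟨v, w, h, rfl⟩

theorem IsSymmetry.isEdge_apply {h : T ≃ᵢ T} (hh : T.IsSymmetry h) {v w : T} (hvw : T.IsEdge v w) :
    T.IsEdge (h v) (h w) where
  left_mem := hh.apply_mem_vertices hvw.left_mem
  right_mem := hh.apply_mem_vertices hvw.right_mem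
  ne := h.injective.ne hvw.ne
  eq_or_eq u hu hu' := by
    obtain ⟨u, rfl⟩ := h.surjective u
    rw [h.mem_metricSegment_iff] at hu
    rw [hh.apply_mem_vertices_iff] at hu'
    exact (hvw.eq_or_eq u hu hu').imp (congrArg h) (congrArg h)

theorem IsSymmetry.image_mem_edges {h : T ≃ᵢ T} (hh : T.IsSymmetry h) {e : Set T}
    (he : e ∈ T.edges) : h '' e ∈ T.edges := by
  obtain ⟨v, w, hvw, rfl⟩ := mem_edges_iff.1 he
  rw [h.image_metricSegment]
  exact (hh.isEdge_apply hvw).mem_edges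

theorem smul_mem_vertices {v : T} (hv : v ∈ T.vertices) (g : G) : v <• g ∈ T.vertices :=
  (T.isSymmetry_translation g).apply_mem_vertices hv

theorem smul_mem_edges {e : Set T} (he : e ∈ T.edges) (g : G) : e <• g ∈ T.edges :=
  (T.isSymmetry_translation g).image_mem_edges he

theorem smul_metricSegment (x y : T) (g : G) :
    metricSegment x y <• g = metricSegment (x <• g) (y <• g) :=
  (T.translation g).image_metricSegment x y

theorem smul_mem_metricSegment_iff {x y p : T} {g : G} :
    p <• g ∈ metricSegment (x <• g) (y <• g) ↔ p ∈ metricSegment x y :=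
  (T.translation g).mem_metricSegment_iff

/-! ### Edges -/

/-- An edge can be left only through its ends: a median of `v, w, y` different from both ends would
be a branch point, hence a vertex, inside the edge. -/
theorem IsEdge.mem_of_not_mem {v w x y : T} (h : T.IsEdge v w) (hx : x ∈ metricSegment v w)
    (hy : y ∉ metricSegment v w ∨ y ∈ T.vertices) :
    v ∈ metricSegment x y ∨ w ∈ metricSegment x y := by
  by_cases hyV : y ∈ metricSegment v w
  · rcases h.eq_or_eq y hyV (hy.resolve_left (not_not.2 hyV)) with rfl | rfl
    · exact Or.inl (right_mem_metricSegment _ _)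
    · exact Or.inr (right_mem_metricSegment _ _)
  obtain ⟨m, h1, h2, h3⟩ := T.isGeodesicTree.exists_median v w y
  rcases eq_or_ne m v with rfl | hmv
  · exact Or.inl (mem_metricSegment_of_left h3 (by rwa [metricSegment_comm]))
  rcases eq_or_ne m w with rfl | hmw
  · exact Or.inr (mem_metricSegment_of_left h2 hx)
  have hmV : m ∉ T.vertices := fun hm => (h.eq_or_eq m h1 hm).elim hmv hmw
  have hmy : y ≠ m := fun e => hyV (e ▸ h1)
  exact absurd (Or.inl (T.isGeodesicTree.not_isRegularPoint_of_three hmv.symm hmw.symm hmy h1 h2 h3))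
    hmV

theorem IsEdge.eq_or_eq_of_mem {v w a b x : T} (h : T.IsEdge v w) (h' : T.IsEdge a b)
    (hx : x ∈ metricSegment v w) (hx' : x ∈ metricSegment a b) (hxV : x ∉ T.vertices) :
    a = v ∨ a = w := by
  have key : ∀ u, u ∈ T.vertices → u ∈ metricSegment x a → a = u := by
    intro u hu hua
    have h1 : metricSegment a x ⊆ metricSegment a b := metricSegment_subset_left hx'
    rcases h'.eq_or_eq u (h1 (by rwa [metricSegment_comm])) hu with rfl | rfl
    · rfl
    · have := IsGeodesicTree.eq_of_mem_of_mem hx' (by rwa [metricSegment_comm])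
      exact absurd (this ▸ hu) hxV
  exact (h.mem_of_not_mem hx (Or.inr h'.left_mem)).imp (key v h.left_mem) (key w h.right_mem)

theorem IsEdge.eq_of_mem {v w a b x : T} (h : T.IsEdge v w) (h' : T.IsEdge a b)
    (hx : x ∈ metricSegment v w) (hx' : x ∈ metricSegment a b) (hxV : x ∉ T.vertices) :
    metricSegment v w = metricSegment a b := by
  rcases h.eq_or_eq_of_mem h' hx hx' hxV with rfl | rfl <;>
    rcases h.eq_or_eq_of_mem h'.symm hx (by rwa [metricSegment_comm]) hxV with rfl | rfl
  · exact absurd rfl h'.ne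
  · rfl
  · exact metricSegment_comm _ _
  · exact absurd rfl h'.ne

theorem eq_of_mem_edges {e e' : Set T} (he : e ∈ T.edges) (he' : e' ∈ T.edges) {x : T}
    (hx : x ∈ e) (hx' : x ∈ e') (hxV : x ∉ T.vertices) : e = e' := by
  obtain ⟨v, w, h, rfl⟩ := mem_edges_iff.1 he
  obtain ⟨a, b, h', rfl⟩ := mem_edges_iff.1 he'
  exact h.eq_of_mem h' hx hx' hxV

/-- The paths from `x` to `a` and to `b` leave the edge through its ends, and not through the same
one, since `x` lies between `a` and `b`. -/
theorem IsEdge.subset_of_mem {v w a b x : T} (h : T.IsEdge v w) (ha : a ∈ T.vertices)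
    (hb : b ∈ T.vertices) (hx : x ∈ metricSegment v w) (hx' : x ∈ metricSegment a b)
    (hxV : x ∉ T.vertices) : metricSegment v w ⊆ metricSegment a b := by
  have ht := T.isGeodesicTree
  have key : ∀ u, u ∈ T.vertices → u ∈ metricSegment x a → u ∈ metricSegment x b → False := by
    intro u hu h1 h2
    rcases ht.mem_or hx' u with h3 | h3
    · exact hxV (IsGeodesicTree.eq_of_mem_of_mem h3 (by rwa [metricSegment_comm]) ▸ hu)
    · exact hxV (IsGeodesicTree.eq_of_mem_of_mem h3 (by rwa [metricSegment_comm]) ▸ hu)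
  have hxa : metricSegment x a ⊆ metricSegment a b := by
    rw [metricSegment_comm x a]; exact metricSegment_subset_left hx'
  have hxb : metricSegment x b ⊆ metricSegment a b := metricSegment_subset_right hx'
  have hsub : ∀ {p q : T}, p ∈ metricSegment x a → q ∈ metricSegment x b →
      metricSegment p q ⊆ metricSegment a b := by
    intro p q hp hq
    have h1 := ht.isPreconnected_metricSegment a b
    exact ht.metricSegment_subset_of_isPreconnected h1 (hxa hp) (hxb hq)
  rcases h.mem_of_not_mem hx (Or.inr ha) with h1 | h1 <;>
    rcases h.mem_of_not_mem hx (Or.inr hb) with h2 | h2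
  · exact (key v h.left_mem h1 h2).elim
  · exact hsub h1 h2
  · rw [metricSegment_comm]; exact hsub h1 h2
  · exact (key w h.right_mem h1 h2).elim

theorem exists_isEdge_of_mem {a b x : T} (ha : a ∈ T.vertices) (hb : b ∈ T.vertices)
    (hx : x ∈ metricSegment a b) (hxV : x ∉ T.vertices) :
    ∃ v w, T.IsEdge v w ∧ x ∈ metricSegment v w ∧ v ∈ metricSegment x a ∧
      w ∈ metricSegment x b := by
  have ht := T.isGeodesicTree
  -- The ends of the edge are the vertices closest to `x` in the two directions; they exist because
  -- vertices form a closed set and segments are compact.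
  have nearest : ∀ c ∈ T.vertices, ∃ v ∈ metricSegment x c, v ∈ T.vertices ∧
      ∀ u ∈ metricSegment x v, u ∈ T.vertices → u = v := by
    intro c hc
    have hK : IsCompact (metricSegment x c ∩ T.vertices) :=
      (ht.isCompact_metricSegment x c).inter_right T.discrete_vertexSet.isClosed
    obtain ⟨v, ⟨hv, hvV⟩, hmin⟩ := hK.exists_isMinOn ⟨c, right_mem_metricSegment _ _, hc⟩
      (f := fun u => dist x u) (by fun_prop)
    refine ⟨v, hv, hvV, fun u hu huV => ?_⟩
    have h1 : dist x v ≤ dist x u := hmin ⟨metricSegment_subset_left hv hu, huV⟩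
    rw [mem_metricSegment] at hu
    exact dist_eq_zero.1 (by linarith [dist_nonneg (x := u) (y := v)])
  obtain ⟨v, hv, hvV, hv'⟩ := nearest a ha
  obtain ⟨w, hw, hwV, hw'⟩ := nearest b hb
  have h1 : x ∈ metricSegment v w :=
    mem_metricSegment_of_right (mem_metricSegment_of_left hx (by rwa [metricSegment_comm])) hw
  refine ⟨v, w, ⟨hvV, hwV, ?_, fun u hu huV => ?_⟩, h1, hv, hw⟩
  · rintro rfl
    rw [metricSegment_self] at h1
    exact hxV (Set.mem_singleton_iff.1 h1 ▸ hvV)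
  · rcases ht.mem_or hu x with h2 | h2
    · exact Or.inl (hv' u (by rwa [metricSegment_comm]) huV)
    · exact Or.inr (hw' u (by rwa [metricSegment_comm]) huV)

/-! ### Invariant convex sets in minimal trees -/

theorem smul_set_eq_of_forall {F : Set T} (hF : ∀ (g : G), ∀ x ∈ F, x <• g ∈ F) (g : G) :
    F <• g = F := by
  apply Set.Subset.antisymm
  · rintro _ ⟨x, hx, rfl⟩
    exact hF g x hx
  · intro x hx
    exact ⟨x <• g⁻¹, hF _ x hx, inv_smul_smul_eq x g⟩

/-- The union of the segments from `v` to the points of `W` is a connected subforest, invariant by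
the tripod property, so minimality makes it the whole tree. -/
theorem mem_metricSegment_of_vertices (hm : T.IsMinimal) {W : Set T} (hW : W ⊆ T.vertices)
    (hinv : ∀ (g : G), ∀ x ∈ W, x <• g ∈ W) {v : T} (hv : v ∈ W) (x : T) :
    ∃ w ∈ W, x ∈ metricSegment v w := by
  have ht := T.isGeodesicTree
  set F : Set T := ⋃ w ∈ W, metricSegment v w with hF
  suffices h : F = Set.univ by
    have hx : x ∈ F := h ▸ Set.mem_univ x
    obtain ⟨w, hw, hx⟩ := Set.mem_iUnion₂.1 hx
    exact ⟨w, hw, hx⟩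
  have hvF : v ∈ F := Set.mem_iUnion₂.2 ⟨v, hv, left_mem_metricSegment _ _⟩
  apply hm
  · refine ⟨{e ∈ T.edges | e ⊆ F}, fun e he => he.1, T.vertices ∩ F, Set.inter_subset_left,
      fun e he u hu => ⟨hu.2, he.2 hu.1⟩, ?_⟩
    apply Set.Subset.antisymm
    · intro y hy
      by_cases hyV : y ∈ T.vertices
      · exact Or.inl ⟨hyV, hy⟩
      · right
        obtain ⟨w, hw, hyw⟩ := Set.mem_iUnion₂.1 hy
        obtain ⟨a, b, hab, hyab, -, -⟩ := exists_isEdge_of_mem (hW hv) (hW hw) hyw hyV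
        exact ⟨_, ⟨hab.mem_edges, (hab.subset_of_mem (hW hv) (hW hw) hyab hyw hyV).trans
          (Set.subset_iUnion₂ (s := fun w _ => metricSegment v w) w hw)⟩, hyab⟩
    · rintro y (hy | ⟨e, he, hy⟩)
      · exact hy.2
      · exact he.2 hy
  · refine ⟨⟨v, hvF⟩, ?_⟩
    rw [hF, ← Set.sUnion_image]
    refine isPreconnected_sUnion v _ ?_ ?_
    · rintro _ ⟨w, -, rfl⟩
      exact left_mem_metricSegment _ _
    · rintro _ ⟨w, -, rfl⟩
      exact ht.isPreconnected_metricSegment _ _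
  · refine smul_set_eq_of_forall fun g y hy => ?_
    obtain ⟨w, hw, hyw⟩ := Set.mem_iUnion₂.1 hy
    have h1 : y <• g ∈ metricSegment (v <• g) (w <• g) := smul_mem_metricSegment_iff.2 hyw
    rcases ht.mem_or h1 v with h2 | h2
    · exact Set.mem_iUnion₂.2 ⟨_, hinv g v hv, by rwa [metricSegment_comm]⟩
    · exact Set.mem_iUnion₂.2 ⟨_, hinv g w hw, by rwa [metricSegment_comm]⟩

theorem exists_isEdge (hm : T.IsMinimal) {v : T} (hv : v ∈ T.vertices) {x : T}
    (hx : x ∉ T.vertices) : ∃ a b, T.IsEdge a b ∧ x ∈ metricSegment a b := by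
  obtain ⟨w, hw, hxw⟩ := mem_metricSegment_of_vertices hm subset_rfl
    (fun g x hx => smul_mem_vertices hx g) hv x
  obtain ⟨a, b, hab, h1, -⟩ := exists_isEdge_of_mem hv hw hxw hx
  exact ⟨a, b, hab, h1⟩

/-- This extends minimality from subforests to arbitrary convex sets. If `F` contains no vertex, it
is confined to one edge, which `G` then stabilises. So `G` is trivial, and a single vertex is
already an invariant subtree, which is absurd. -/
theorem eq_univ_of_convex (hm : T.IsMinimal) (he : T.IsEdgeFree) (hV : T.vertices.Nonempty)
    {F : Set T} (hF : F.Nonempty) (hinv : ∀ (g : G), ∀ x ∈ F, x <• g ∈ F)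
    (hconv : ∀ x ∈ F, ∀ y ∈ F, metricSegment x y ⊆ F) : F = Set.univ := by
  by_cases hFV : (T.vertices ∩ F).Nonempty
  · obtain ⟨v, hv⟩ := hFV
    refine Set.eq_univ_of_forall fun x => ?_
    obtain ⟨w, hw, hxw⟩ := mem_metricSegment_of_vertices hm (W := T.vertices ∩ F)
      Set.inter_subset_left (fun g x hx => ⟨smul_mem_vertices hx.1 g, hinv g x hx.2⟩) hv x
    exact hconv v hv.2 w hw.2 hxw
  exfalso
  obtain ⟨x, hx⟩ := hF
  obtain ⟨v, hv⟩ := hV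
  have hnot : ∀ y ∈ F, y ∉ T.vertices := fun y hy hyV => hFV ⟨y, hyV, hy⟩
  obtain ⟨a, b, hab, hxab⟩ := exists_isEdge hm hv (hnot x hx)
  have htriv : ∀ g : G, g = 1 := by
    intro g
    refine he.edge_stabilizer _ hab.mem_edges g ?_
    have h1 : x <• g ∈ metricSegment (a <• g) (b <• g) := smul_mem_metricSegment_iff.2 hxab
    have h2 : x <• g ∈ metricSegment a b := by
      by_contra hcon
      rcases hab.mem_of_not_mem hxab (Or.inl hcon) with h3 | h3
      · exact hnot a (hconv _ hx _ (hinv g x hx) h3) hab.left_mem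
      · exact hnot b (hconv _ hx _ (hinv g x hx) h3) hab.right_mem
    refine eq_of_mem_edges (smul_mem_edges hab.mem_edges g) hab.mem_edges (x := x <• g) ?_ h2
      (hnot _ (hinv g x hx))
    rwa [smul_metricSegment]
  obtain ⟨w, hw, hxw⟩ := mem_metricSegment_of_vertices hm (W := {v})
    (Set.singleton_subset_iff.2 hv) (fun g y hy => by rwa [htriv g, smul_one_eq]) rfl x
  rw [Set.mem_singleton_iff.1 hw, metricSegment_self] at hxw
  exact hnot x hx (Set.mem_singleton_iff.1 hxw ▸ hv)

end GTree

namespace GTree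

variable {G : Type u} [Group G] {T : GTree G}

/-! ### Consequences of cocompactness -/

theorem IsCocompact.exists_finset_cover (hc : T.IsCocompact) (ρ : T → ℝ) (hρ : ∀ x, 0 < ρ x) :
    ∃ t : Finset T, ∀ y : T, ∃ x ∈ t, ∃ g : G, dist (y <• g) x < ρ x := by
  classical
  have hc' : CompactSpace (MulAction.orbitRel.Quotient Gᵐᵒᵖ T) := hc
  obtain ⟨t, -, ht⟩ := (isCompact_univ (X := MulAction.orbitRel.Quotient Gᵐᵒᵖ T)).elim_nhds_subcover
    (fun q => (Quotient.mk'' : T → MulAction.orbitRel.Quotient Gᵐᵒᵖ T) ''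
      Metric.ball q.out (ρ q.out)) (fun q _ => by
        refine IsOpen.mem_nhds (isOpenMap_quotient_mk'_mul _ Metric.isOpen_ball) ?_
        exact ⟨q.out, Metric.mem_ball_self (hρ _), q.out_eq'⟩)
  refine ⟨t.image fun q => q.out, fun y => ?_⟩
  obtain ⟨q, hq, z, hz, hzy⟩ := Set.mem_iUnion₂.1
    (ht (Set.mem_univ (Quotient.mk'' y : MulAction.orbitRel.Quotient Gᵐᵒᵖ T)))
  obtain ⟨g, hg⟩ := Quotient.exact' hzy
  refine ⟨_, Finset.mem_image_of_mem _ hq, g.unop, ?_⟩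
  rw [MulOpposite.op_unop]
  have hg' : g • y = z := hg
  rw [hg']
  exact hz

/-- A Lebesgue number argument: two vertices that are too close can be moved together into a ball
containing at most one vertex. -/
theorem IsCocompact.exists_separation (hc : T.IsCocompact) :
    ∃ ε > 0, ∀ v ∈ T.vertices, ∀ w ∈ T.vertices, v ≠ w → ε ≤ dist v w := by
  have hdisc := T.discrete_vertexSet
  choose ε hε hs using hdisc
  obtain ⟨t, ht⟩ := hc.exists_finset_cover (fun x => ε x / 2) (fun x => half_pos (hε x))
  obtain ⟨x₀, hx₀, -⟩ := ht (Classical.arbitrary T)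
  obtain ⟨x₁, hx₁, hmin⟩ := t.exists_min_image ε ⟨x₀, hx₀⟩
  refine ⟨ε x₁ / 2, half_pos (hε x₁), fun v hv w hw hne => ?_⟩
  by_contra! hlt
  obtain ⟨x, hx, g, hg⟩ := ht v
  have h1 := hmin x hx
  have h2 := dist_smul_eq w v g
  have h3 := dist_triangle (w <• g) (v <• g) x
  rw [dist_comm w v] at h2
  have e1 := hs x _ (smul_mem_vertices hv g) (by linarith [hε x])
  have e2 := hs x _ (smul_mem_vertices hw g) (by linarith)
  exact hne ((T.translation g).injective (e1.trans e2.symm))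

theorem IsCocompact.exists_finite_representatives (hc : T.IsCocompact) {W : Set T} {δ : ℝ}
    (hδ : 0 < δ) (hinv : ∀ (g : G), ∀ x ∈ W, x <• g ∈ W)
    (hsep : ∀ x ∈ W, ∀ y ∈ W, x ≠ y → δ ≤ dist x y) :
    ∃ s : Set T, s.Finite ∧ ∀ x ∈ W, ∃ g : G, x <• g ∈ s := by
  obtain ⟨t, ht⟩ := hc.exists_finset_cover (fun _ => δ / 2) (fun _ => half_pos hδ)
  refine ⟨⋃ x ∈ t, W ∩ Metric.ball x (δ / 2), ?_, fun x hx => ?_⟩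
  · refine t.finite_toSet.biUnion fun x _ => Set.Subsingleton.finite ?_
    rintro y ⟨hy, hy'⟩ z ⟨hz, hz'⟩
    by_contra hne
    rw [Metric.mem_ball] at hy' hz'
    linarith [hsep y hy z hz hne, dist_triangle y x z, dist_comm x z]
  · obtain ⟨y, hy, g, hg⟩ := ht x
    exact ⟨g, Set.mem_iUnion₂.2 ⟨y, hy, hinv g x hx, hg⟩⟩

theorem IsEdge.exists_midpoint {v w : T} (h : T.IsEdge v w) :
    ∃ m ∈ metricSegment v w, dist v m = dist m w ∧ m ∉ T.vertices := by
  have hpos := dist_pos.2 h.ne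
  obtain ⟨m, h1, h2⟩ := T.isGeodesicTree.exists_dist_eq v w (dist v w / 2) (by linarith)
    (by linarith)
  have hm : m ∈ metricSegment v w := by rw [mem_metricSegment]; linarith
  refine ⟨m, hm, by linarith, fun hmV => ?_⟩
  rcases h.eq_or_eq m hm hmV with rfl | rfl
  · rw [dist_self] at h1; linarith
  · linarith

theorem edgeOrbit_eq_iff {e e' : T.edges} :
    T.edgeOrbit e = T.edgeOrbit e' ↔ ∃ g : G, (e' : Set T) <• g = e := by
  constructor
  · intro h
    obtain ⟨g, hg⟩ := Quotient.exact h
    exact ⟨g.unop, hg⟩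
  · rintro ⟨g, hg⟩
    exact Quotient.sound ⟨MulOpposite.op g, hg⟩

theorem IsCocompact.finite_edgeOrbit (hc : T.IsCocompact) : Finite T.EdgeOrbit := by
  have ht := T.isGeodesicTree
  obtain ⟨ε, hε, hsep⟩ := hc.exists_separation
  -- Edges are counted by their midpoints, which are uniformly separated because edge lengths are
  -- bounded below.
  set W : Set T := {m | ∃ v w, T.IsEdge v w ∧ m ∈ metricSegment v w ∧ dist v m = dist m w ∧
    m ∉ T.vertices} with hW
  have hWsep : ∀ x ∈ W, ∀ y ∈ W, x ≠ y → ε / 2 ≤ dist x y := by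
    rintro x ⟨v, w, hvw, hx, hxd, hxV⟩ y ⟨a, b, hab, hy, hyd, hyV⟩ hne
    have hv := hsep v hvw.left_mem w hvw.right_mem hvw.ne
    by_cases hyv : y ∈ metricSegment v w
    · exfalso
      rcases hvw.eq_or_eq_of_mem hab hyv hy hyV with rfl | rfl <;>
        rcases hvw.eq_or_eq_of_mem hab.symm hyv (by rwa [metricSegment_comm]) hyV with rfl | rfl
      · exact hab.ne rfl
      · refine hne (ht.eq_of_dist_eq hx hyv ?_)
        rw [mem_metricSegment] at hx hy
        linarith
      · refine hne (ht.eq_of_dist_eq hx hyv ?_)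
        rw [mem_metricSegment] at hx hyv
        rw [dist_comm a y, dist_comm y b] at hyd
        linarith
      · exact hab.ne rfl
    · rcases hvw.mem_of_not_mem hx (Or.inl hyv) with h1 | h1 <;> rw [mem_metricSegment] at hx h1
      · linarith [dist_comm v x, dist_nonneg (x := v) (y := y)]
      · linarith [dist_nonneg (x := w) (y := y)]
  have hWinv : ∀ (g : G), ∀ x ∈ W, x <• g ∈ W := by
    rintro g x ⟨v, w, hvw, hx, hxd, hxV⟩
    have hg := T.isSymmetry_translation g
    refine ⟨v <• g, w <• g, hg.isEdge_apply hvw, smul_mem_metricSegment_iff.2 hx, ?_, ?_⟩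
    · rwa [dist_smul_eq, dist_smul_eq]
    · exact fun h => hxV (hg.apply_mem_vertices_iff.1 h)
  obtain ⟨s, hs, hWs⟩ := hc.exists_finite_representatives (half_pos hε) hWinv hWsep
  have key : ∀ q : T.EdgeOrbit, ∃ p : s, ∃ e : T.edges, T.edgeOrbit e = q ∧ (p : T) ∈ (e : Set T) ∧
      (p : T) ∉ T.vertices := by
    intro q
    obtain ⟨⟨e, he⟩, rfl⟩ := Quotient.exists_rep q
    obtain ⟨v, w, hvw, rfl⟩ := mem_edges_iff.1 he
    obtain ⟨m, h1, h2, h3⟩ := hvw.exists_midpoint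
    obtain ⟨g, hg⟩ := hWs m ⟨v, w, hvw, h1, h2, h3⟩
    refine ⟨⟨_, hg⟩, ⟨_, smul_mem_edges he g⟩, edgeOrbit_eq_iff.2 ⟨g, rfl⟩, ⟨m, h1, rfl⟩, ?_⟩
    exact fun h => h3 ((T.isSymmetry_translation g).apply_mem_vertices_iff.1 h)
  choose p hp using key
  have := hs.to_subtype
  refine Finite.of_injective p fun q q' hqq => ?_
  obtain ⟨e, he, h1, h2⟩ := hp q
  obtain ⟨e', he', h1', -⟩ := hp q'
  rw [← hqq] at h1'
  rw [← he, ← he', Subtype.ext (eq_of_mem_edges e.2 e'.2 h1 h1' h2)]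

/-! ### Valence -/

theorem exists_isEdge_toward (hm : T.IsMinimal) {v x : T} (hv : v ∈ T.vertices) (hx : x ≠ v) :
    ∃ w, T.IsEdge v w ∧ v ∉ metricSegment w x := by
  have ht := T.isGeodesicTree
  obtain ⟨u, hu, hxu⟩ := mem_metricSegment_of_vertices hm subset_rfl
    (fun g x hx => smul_mem_vertices hx g) hv x
  obtain ⟨ε, hε, hs⟩ := T.discrete_vertexSet v
  have hpos := dist_pos.2 hx.symm
  have hmin : 0 < min ε (dist v x) := lt_min hε hpos
  obtain ⟨y, hy1, hy2⟩ := ht.exists_dist_eq v x (min ε (dist v x) / 2) (by linarith)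
    (by linarith [min_le_right ε (dist v x)])
  have hyε : dist v y < ε := by linarith [min_le_left ε (dist v x)]
  have hyv : y ≠ v := by
    rintro rfl
    rw [dist_self] at hy1
    linarith
  have hyx : y ∈ metricSegment v x := by rw [mem_metricSegment]; linarith
  have hyV : y ∉ T.vertices := fun h => hyv (hs y h (by rwa [dist_comm]))
  obtain ⟨a, b, hab, hyab, ha, -⟩ := exists_isEdge_of_mem hv hu
    (metricSegment_subset_left hxu hyx) hyV
  obtain rfl : a = v := hs a hab.left_mem (by
    rw [mem_metricSegment] at ha
    linarith [dist_comm v y, dist_nonneg (x := y) (y := a)])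
  refine ⟨b, hab, fun hcon => ?_⟩
  rcases ht.mem_or hcon y with h1 | h1
  · exact hyv (IsGeodesicTree.eq_of_mem_of_mem (x := b) (by rwa [metricSegment_comm]) h1)
  · exact hyv (IsGeodesicTree.eq_of_mem_of_mem (x := x) (by rwa [metricSegment_comm]) h1)

theorem IsEdge.ne_of_mem {v w w' : T} (h : T.IsEdge v w) (h' : T.IsEdge v w')
    (hv : v ∈ metricSegment w w') : metricSegment v w ≠ metricSegment v w' := by
  intro e
  have h1 : w ∈ metricSegment v w' := e ▸ right_mem_metricSegment v w
  rcases h'.eq_or_eq w h1 h.right_mem with rfl | rfl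
  · exact h.ne rfl
  · rw [metricSegment_self] at hv
    exact h.ne hv

theorem IsEdge.mem_of_ne {v w w' : T} (h : T.IsEdge v w) (h' : T.IsEdge v w')
    (hne : metricSegment v w ≠ metricSegment v w') : v ∈ metricSegment w w' := by
  obtain ⟨m, h1, h2, h3⟩ := T.isGeodesicTree.exists_median v w w'
  by_cases hmV : m ∈ T.vertices
  · rcases h.eq_or_eq m h1 hmV with rfl | rfl
    · exact h3
    · rcases h'.eq_or_eq m h2 hmV with rfl | rfl
      · exact h3
      · exact absurd rfl hne
  · exact absurd (h.eq_of_mem h' h1 h2 hmV) hne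

theorem not_isRegularPoint_of_stabilizer {v : T} (hv : v ∈ T.vertices)
    (hs : ∀ g : G, v <• g = v → g = 1) : ¬ IsRegularPoint v := by
  rcases hv with h | ⟨g, a, b, hab, h1, h2, h3, h4⟩
  · exact h
  have h5 : v <• g = v := T.isGeodesicTree.apply_midpoint_eq (T.translation g) h1 h2 h3 h4
  rw [hs g h5, smul_one_eq] at h1
  exact absurd h1 hab

/-- There are no leaves: the complement of the orbit of a leaf would be convex, invariant and
non-empty, since it contains `x`. -/
theorem exists_separated_by_vertex (hm : T.IsMinimal) (he : T.IsEdgeFree) {v x : T}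
    (hv : v ∈ T.vertices) (hx : x ∉ T.vertices) :
    ∃ y z, y ≠ v ∧ z ≠ v ∧ v ∈ metricSegment y z := by
  by_contra! hcon
  have h1 : ({y | ∀ g : G, y ≠ v <• g} : Set T) = Set.univ := by
    refine eq_univ_of_convex hm he ⟨v, hv⟩ ⟨x, ?_⟩ ?_ ?_
    · rintro g rfl
      exact hx (smul_mem_vertices hv g)
    · intro g y hy k e
      refine hy (k * g⁻¹) ?_
      rw [← smul_smul_eq, ← e, smul_inv_smul_eq]
    · rintro y hy z hz p hp g rfl
      refine hcon (y <• g⁻¹) (z <• g⁻¹) ?_ ?_ ?_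
      · rintro e
        exact hy g (by rw [← e, inv_smul_smul_eq])
      · rintro e
        exact hz g (by rw [← e, inv_smul_smul_eq])
      · rw [← smul_inv_smul_eq v g, smul_mem_metricSegment_iff]
        exact hp
  have h2 : v ∈ ({y | ∀ g : G, y ≠ v <• g} : Set T) := h1 ▸ Set.mem_univ v
  exact h2 1 (smul_one_eq v).symm

theorem exists_three_edges (hm : T.IsMinimal) (he : T.IsEdgeFree) {v x : T}
    (hv : v ∈ T.vertices) (hx : x ∉ T.vertices) (hs : ∀ g : G, v <• g = v → g = 1) :
    ∃ e₁ ∈ T.edges, ∃ e₂ ∈ T.edges, ∃ e₃ ∈ T.edges, v ∈ e₁ ∧ v ∈ e₂ ∧ v ∈ e₃ ∧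
      e₁ ≠ e₂ ∧ e₁ ≠ e₃ ∧ e₂ ≠ e₃ := by
  have ht := T.isGeodesicTree
  obtain ⟨a, b, ha, hb, hab⟩ := exists_separated_by_vertex hm he hv hx
  obtain ⟨c, hc, hac, hbc⟩ := ht.exists_third_direction
    (not_isRegularPoint_of_stabilizer hv hs) ha hb hab
  obtain ⟨a', ha1, ha2⟩ := exists_isEdge_toward hm hv ha
  obtain ⟨b', hb1, hb2⟩ := exists_isEdge_toward hm hv hb
  obtain ⟨c', hc1, hc2⟩ := exists_isEdge_toward hm hv hc
  have key : ∀ {y z y' z' : T}, v ∈ metricSegment y z → v ∉ metricSegment y' y →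
      v ∉ metricSegment z' z → v ∈ metricSegment y' z' := by
    intro y z y' z' h1 h2 h3
    rcases ht.mem_or h1 y' with h4 | h4
    · exact absurd (by rwa [metricSegment_comm]) h2
    rcases ht.mem_or h4 z' with h5 | h5
    · exact absurd (by rwa [metricSegment_comm]) h3
    · exact h5
  exact ⟨_, ha1.mem_edges, _, hb1.mem_edges, _, hc1.mem_edges, left_mem_metricSegment _ _,
    left_mem_metricSegment _ _, left_mem_metricSegment _ _,
    ha1.ne_of_mem hb1 (key hab ha2 hb2), ha1.ne_of_mem hc1 (key hac ha2 hc2),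
    hb1.ne_of_mem hc1 (key hbc hb2 hc2)⟩

end GTree

/-! ### The length of the part of a segment lying in a given set of edges -/

theorem IsGeodesicTree.hausdorffMeasure_metricSegment {X : Type u} [MetricSpace X]
    [MeasurableSpace X] [BorelSpace X] (h : IsGeodesicTree X) (x y : X) :
    MeasureTheory.Measure.hausdorffMeasure 1 (metricSegment x y) = ENNReal.ofReal (dist x y) := by
  obtain ⟨σ, h1, -, -, h2⟩ := h.exists_param x y
  have hi : Isometry fun s : Set.Icc (0 : ℝ) (dist x y) => σ s :=
    Isometry.of_dist_eq fun s t => h1 s s.2 t t.2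
  have e1 := hi.hausdorffMeasure_image (d := 1) (Or.inl zero_le_one) Set.univ
  have e2 := (isometry_subtype_coe (s := Set.Icc (0 : ℝ) (dist x y))).hausdorffMeasure_image
    (d := 1) (Or.inl zero_le_one) Set.univ
  rw [Set.image_univ, Subtype.range_coe, MeasureTheory.hausdorffMeasure_real, Real.volume_Icc,
    sub_zero] at e2
  rw [e2, ← e1, ← h2, Set.image_univ]
  congr 1
  ext p
  simp

namespace GTree

variable {G : Type u} [Group G]

instance (T : GTree G) : MeasurableSpace T := borel T

instance (T : GTree G) : BorelSpace T := ⟨rfl⟩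

/-- A `G`-invariant set of edges. -/
structure EdgeFamily (T : GTree G) where
  /-- The underlying set of edges. -/
  carrier : Set (Set T)
  subset_edges : carrier ⊆ T.edges
  smul_mem : ∀ e ∈ carrier, ∀ g : G, e <• g ∈ carrier

/-- One-dimensional Hausdorff measure on the union of a set of edges. -/
noncomputable def edgeMeasure {T : GTree G} (E : T.EdgeFamily) : MeasureTheory.Measure T :=
  (MeasureTheory.Measure.hausdorffMeasure 1).restrict (⋃₀ E.carrier)

/-- The length of the part of the segment from `x` to `y` lying in the edges belonging to `E`. -/
noncomputable def edgeLength {T : GTree G} (E : T.EdgeFamily) (x y : T) : ℝ :=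
  (edgeMeasure E (metricSegment x y)).toReal

section EdgeLength

variable {T : GTree G} {E : T.EdgeFamily} {x y z : T}

theorem edgeMeasure_apply (x y : T) : edgeMeasure E (metricSegment x y) =
    MeasureTheory.Measure.hausdorffMeasure 1 (metricSegment x y ∩ ⋃₀ E.carrier) :=
  MeasureTheory.Measure.restrict_apply (isClosed_metricSegment x y).measurableSet

theorem edgeMeasure_le (x y : T) :
    edgeMeasure E (metricSegment x y) ≤ ENNReal.ofReal (dist x y) := by
  rw [edgeMeasure_apply, ← T.isGeodesicTree.hausdorffMeasure_metricSegment]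
  exact MeasureTheory.measure_mono Set.inter_subset_left

theorem edgeMeasure_ne_top (x y : T) : edgeMeasure E (metricSegment x y) ≠ ⊤ :=
  ((edgeMeasure_le x y).trans_lt ENNReal.ofReal_lt_top).ne

theorem edgeLength_nonneg (x y : T) : 0 ≤ edgeLength E x y := ENNReal.toReal_nonneg

theorem edgeLength_le_dist (x y : T) : edgeLength E x y ≤ dist x y :=
  ENNReal.toReal_le_of_le_ofReal dist_nonneg (edgeMeasure_le x y)

theorem edgeLength_comm (x y : T) : edgeLength E x y = edgeLength E y x := by
  rw [edgeLength, edgeLength, metricSegment_comm]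

theorem edgeLength_self (x : T) : edgeLength E x x = 0 :=
  le_antisymm ((edgeLength_le_dist x x).trans (dist_self x).le) (edgeLength_nonneg x x)

theorem edgeLength_add (hy : y ∈ metricSegment x z) :
    edgeLength E x y + edgeLength E y z = edgeLength E x z := by
  have ht := T.isGeodesicTree
  have hun : metricSegment x z = metricSegment x y ∪ metricSegment y z :=
    Set.Subset.antisymm (ht.metricSegment_subset_union x y z)
      (Set.union_subset (metricSegment_subset_left hy) (metricSegment_subset_right hy))
  have hdis : MeasureTheory.AEDisjoint (edgeMeasure E) (metricSegment x y) (metricSegment y z) := by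
    have hsub : metricSegment x y ∩ metricSegment y z ⊆ {y} := by
      rintro p ⟨h1, h2⟩
      rw [mem_metricSegment] at *
      have := dist_triangle x p z
      have := dist_comm y p
      exact dist_eq_zero.1 (by linarith [dist_nonneg (x := p) (y := y)])
    refine MeasureTheory.measure_mono_null hsub ?_
    have h1 := MeasureTheory.Measure.restrict_apply_le (μ := MeasureTheory.Measure.hausdorffMeasure 1)
      (⋃₀ E.carrier) {y}
    rw [← metricSegment_self] at h1 ⊢
    rw [ht.hausdorffMeasure_metricSegment, dist_self, ENNReal.ofReal_zero] at h1
    exact le_antisymm h1 zero_le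
  rw [edgeLength, edgeLength, edgeLength, hun, MeasureTheory.measure_union₀
    (isClosed_metricSegment y z).measurableSet.nullMeasurableSet hdis,
    ENNReal.toReal_add (edgeMeasure_ne_top _ _) (edgeMeasure_ne_top _ _)]

theorem edgeLength_triangle (x y z : T) :
    edgeLength E x z ≤ edgeLength E x y + edgeLength E y z := by
  rw [edgeLength, edgeLength, edgeLength,
    ← ENNReal.toReal_add (edgeMeasure_ne_top _ _) (edgeMeasure_ne_top _ _)]
  exact ENNReal.toReal_mono (ENNReal.add_ne_top.2 ⟨edgeMeasure_ne_top _ _, edgeMeasure_ne_top _ _⟩)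
    ((MeasureTheory.measure_mono (T.isGeodesicTree.metricSegment_subset_union x y z)).trans
      (MeasureTheory.measure_union_le _ _))

theorem edgeLength_four_point (x y z w : T) : edgeLength E x y + edgeLength E z w ≤
    max (edgeLength E x z + edgeLength E y w) (edgeLength E x w + edgeLength E y z) := by
  have ht := T.isGeodesicTree
  -- Here `m` and `n` are the points where `z` and `w` branch off `[x, y]`; their order decides
  -- which pairing is the larger.
  obtain ⟨m, h1, h2, h3⟩ := ht.exists_median x y z
  obtain ⟨n, k1, k2, k3⟩ := ht.exists_median x y w
  have a1 := edgeLength_add (E := E) h1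
  have a2 := edgeLength_add (E := E) h2
  have a3 := edgeLength_add (E := E) h3
  have b1 := edgeLength_add (E := E) k1
  have b2 := edgeLength_add (E := E) k2
  have b3 := edgeLength_add (E := E) k3
  have t1 := edgeLength_triangle (E := E) z m w
  have t2 := edgeLength_triangle (E := E) m n w
  have c1 := edgeLength_comm (E := E) y m
  have c2 := edgeLength_comm (E := E) y n
  have c3 := edgeLength_comm (E := E) z m
  have c4 := edgeLength_comm (E := E) n m
  rcases ht.mem_or k1 m with h | h
  · have := edgeLength_add (E := E) h
    exact le_max_of_le_left (by linarith)
  · have := edgeLength_add (E := E) h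
    exact le_max_of_le_right (by linarith)

theorem edgeLength_apply (h : T ≃ᵢ T) (hE : h '' ⋃₀ E.carrier = ⋃₀ E.carrier) (x y : T) :
    edgeLength E (h x) (h y) = edgeLength E x y := by
  rw [edgeLength, edgeLength, edgeMeasure_apply, edgeMeasure_apply, ← h.image_metricSegment]
  nth_rw 1 [← hE]
  rw [← Set.image_inter h.injective, h.hausdorffMeasure_image]

theorem edgeLength_smul (x y : T) (g : G) :
    edgeLength E (x <• g) (y <• g) = edgeLength E x y :=
  edgeLength_apply (T.translation g) (smul_set_eq_of_forall (fun k z hz => by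
    obtain ⟨e, he, hze⟩ := hz
    exact ⟨_, E.smul_mem e he k, z, hze, rfl⟩) g) x y

/-- A segment contains only finitely many vertices, and these have measure zero. -/
theorem exists_mem_of_edgeLength_pos (h : 0 < edgeLength E x y) :
    ∃ z ∈ metricSegment x y, z ∉ T.vertices ∧ ∃ e ∈ E.carrier, z ∈ e := by
  by_contra! hcon
  have hsub : metricSegment x y ∩ ⋃₀ E.carrier ⊆ metricSegment x y ∩ T.vertices := by
    rintro z ⟨hz, e, he, hze⟩
    exact ⟨hz, by_contra fun hzV => hcon z hz hzV e he hze⟩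
  have hfin := T.discrete_vertexSet.finite_inter (T.isGeodesicTree.isCompact_metricSegment x y)
  have := MeasureTheory.Measure.nullSingletonClass_hausdorff T (d := 1) one_pos
  rw [edgeLength, edgeMeasure_apply,
    MeasureTheory.measure_mono_null hsub (hfin.measure_zero _)] at h
  exact lt_irrefl _ h

theorem edgeLength_eq_dist (h : metricSegment x y ⊆ ⋃₀ E.carrier) :
    edgeLength E x y = dist x y := by
  rw [edgeLength, edgeMeasure_apply, Set.inter_eq_left.2 h,
    T.isGeodesicTree.hausdorffMeasure_metricSegment, ENNReal.toReal_ofReal dist_nonneg]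

theorem IsEdge.edgeLength_eq_zero {v w : T} (h : T.IsEdge v w)
    (hE : metricSegment v w ∉ E.carrier) : edgeLength E v w = 0 := by
  by_contra hne
  obtain ⟨z, hz, hzV, e, he, hze⟩ := exists_mem_of_edgeLength_pos
    (lt_of_le_of_ne (edgeLength_nonneg v w) (Ne.symm hne))
  exact hE (eq_of_mem_edges h.mem_edges (E.subset_edges he) hz hze hzV ▸ he)

theorem edgeLength_eq_zero_of_mem {e : Set T} (he : e ∈ T.edges) (heE : e ∉ E.carrier)
    (hx : x ∈ e) (hy : y ∈ e) : edgeLength E x y = 0 := by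
  obtain ⟨v, w, h, rfl⟩ := mem_edges_iff.1 he
  have h0 := h.edgeLength_eq_zero heE
  have h1 := edgeLength_add (E := E) hx
  have h2 := edgeLength_add (E := E) hy
  have h3 := edgeLength_triangle (E := E) x v y
  have h4 := edgeLength_comm (E := E) x v
  linarith [edgeLength_nonneg (E := E) v x, edgeLength_nonneg (E := E) x w,
    edgeLength_nonneg (E := E) v y, edgeLength_nonneg (E := E) y w,
    edgeLength_nonneg (E := E) x y]

theorem IsEdge.edgeLength_pos {v w : T} (h : T.IsEdge v w) (hE : metricSegment v w ∈ E.carrier)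
    (hx : x ∈ metricSegment v w) (hxV : x ∉ T.vertices) (hy : y ≠ x) : 0 < edgeLength E x y := by
  have ht := T.isGeodesicTree
  have key : ∀ u ∈ metricSegment v w, u ≠ x → 0 < edgeLength E x u := by
    intro u hu hux
    rw [edgeLength_eq_dist]
    · exact dist_pos.2 hux.symm
    · exact (ht.metricSegment_subset_of_isPreconnected (ht.isPreconnected_metricSegment v w)
        hx hu).trans (Set.subset_sUnion_of_mem hE)
  by_cases hyv : y ∈ metricSegment v w
  · exact key y hyv hy
  rcases h.mem_of_not_mem hx (Or.inl hyv) with h1 | h1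
  · have h2 := edgeLength_add (E := E) h1
    linarith [key v (left_mem_metricSegment _ _) fun e => hxV (e ▸ h.left_mem),
      edgeLength_nonneg (E := E) v y]
  · have h2 := edgeLength_add (E := E) h1
    linarith [key w (right_mem_metricSegment _ _) fun e => hxV (e ▸ h.right_mem),
      edgeLength_nonneg (E := E) w y]

theorem edgeLength_pos_of_mem {e : Set T} (he : e ∈ E.carrier) (hx : x ∈ e)
    (hxV : x ∉ T.vertices) (hy : y ≠ x) : 0 < edgeLength E x y := by
  obtain ⟨v, w, h, rfl⟩ := mem_edges_iff.1 (E.subset_edges he)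
  exact h.edgeLength_pos he hx hxV hy

/-- A segment between vertices with positive length in `E` contains an entire edge of `E`. This gap
makes the vertices of the collapse discrete. -/
theorem IsCocompact.exists_edgeLength_gap (hc : T.IsCocompact) (E : T.EdgeFamily) :
    ∃ ε > 0, ∀ v ∈ T.vertices, ∀ w ∈ T.vertices, edgeLength E v w = 0 ∨
      ε ≤ edgeLength E v w := by
  obtain ⟨ε, hε, hsep⟩ := hc.exists_separation
  refine ⟨ε, hε, fun v hv w hw => ?_⟩
  rcases (edgeLength_nonneg (E := E) v w).eq_or_lt with h | h
  · exact Or.inl h.symm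
  right
  obtain ⟨z, hz, hzV, e, he, hze⟩ := exists_mem_of_edgeLength_pos h
  obtain ⟨a, b, hab, rfl⟩ := mem_edges_iff.1 (E.subset_edges he)
  have hsub := hab.subset_of_mem hv hw hze hz hzV
  have h1 : edgeLength E a b = dist a b := edgeLength_eq_dist (Set.subset_sUnion_of_mem he)
  have h2 : edgeLength E a b ≤ edgeLength E v w :=
    ENNReal.toReal_mono (edgeMeasure_ne_top _ _) (MeasureTheory.measure_mono hsub)
  linarith [hsep a hab.left_mem b hab.right_mem hab.ne]

theorem IsCocompact.exists_edgeLength_gap_at (hc : T.IsCocompact) (hm : T.IsMinimal)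
    (E : T.EdgeFamily) (x : T) :
    ∃ ε > 0, ∀ v ∈ T.vertices, edgeLength E x v = 0 ∨ ε ≤ edgeLength E x v := by
  obtain ⟨ε, hε, hgap⟩ := hc.exists_edgeLength_gap E
  have hv : ∀ a ∈ T.vertices, edgeLength E x a = 0 → ∀ v ∈ T.vertices,
      edgeLength E x v = 0 ∨ ε ≤ edgeLength E x v := by
    intro a ha hxa v hv
    have e : edgeLength E x v = edgeLength E a v := by
      have h1 := edgeLength_triangle (E := E) x a v
      have h2 := edgeLength_triangle (E := E) a x v
      have h3 := edgeLength_comm (E := E) a x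
      linarith
    rw [e]
    exact hgap a ha v hv
  by_cases hxV : x ∈ T.vertices
  · exact ⟨ε, hε, hv x hxV (edgeLength_self x)⟩
  rcases T.vertices.eq_empty_or_nonempty with hV | ⟨v₀, hv₀⟩
  · exact ⟨1, one_pos, fun v hv => absurd hv (hV ▸ Set.notMem_empty v)⟩
  obtain ⟨a, b, hab, hx⟩ := exists_isEdge hm hv₀ hxV
  rcases (edgeLength_nonneg (E := E) x a).eq_or_lt with ha | ha
  · exact ⟨ε, hε, hv a hab.left_mem ha.symm⟩
  rcases (edgeLength_nonneg (E := E) x b).eq_or_lt with hb | hb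
  · exact ⟨ε, hε, hv b hab.right_mem hb.symm⟩
  refine ⟨_, lt_min ha hb, fun v hvV => Or.inr ?_⟩
  rcases hab.mem_of_not_mem hx (Or.inr hvV) with h | h
  · have := edgeLength_add (E := E) h
    exact min_le_of_left_le (by linarith [edgeLength_nonneg (E := E) a v])
  · have := edgeLength_add (E := E) h
    exact min_le_of_right_le (by linarith [edgeLength_nonneg (E := E) b v])

theorem exists_edgeLength_eq (x y : T) {s : ℝ} (h0 : 0 ≤ s) (h1 : s ≤ edgeLength E x y) :
    ∃ p ∈ metricSegment x y, edgeLength E x p = s := by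
  obtain ⟨σ, hσ, hσ0, hσD, him⟩ := T.isGeodesicTree.exists_param x y
  have hlip : ∀ p q : T, |edgeLength E x p - edgeLength E x q| ≤ dist p q := by
    intro p q
    have a1 := edgeLength_triangle (E := E) x p q
    have a2 := edgeLength_triangle (E := E) x q p
    have a3 := edgeLength_comm (E := E) p q
    have a4 := edgeLength_le_dist (E := E) p q
    rw [abs_le]
    constructor <;> linarith
  have hcont : Continuous fun p => edgeLength E x p :=
    (LipschitzWith.of_dist_le_mul (K := 1) fun p q => by
      rw [Real.dist_eq, NNReal.coe_one, one_mul]; exact hlip p q).continuous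
  obtain ⟨t, ht, hts⟩ := intermediate_value_Icc dist_nonneg
    (hcont.comp_continuousOn (IsGeodesicTree.continuousOn_of_dist_eq hσ))
    (show s ∈ Set.Icc _ _ by
      simp only [Function.comp_apply]
      rw [hσ0, hσD, edgeLength_self]
      exact ⟨h0, h1⟩)
  exact ⟨σ t, him ▸ ⟨t, ht, rfl⟩, hts⟩

end EdgeLength

end GTree

namespace GTree

variable {G : Type u} [Group G] {T : GTree G}

/-! ### Collapsing the edges outside a given set -/

/-- The tree `T` with the pseudometric in which the edges outside `E` have length zero. -/
def PreCollapse (_E : T.EdgeFamily) : Type u := T.carrier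

section PreCollapse

variable (E : T.EdgeFamily)

noncomputable instance : PseudoMetricSpace (PreCollapse E) where
  dist x y := edgeLength (T := T) E x y
  dist_self x := edgeLength_self (T := T) x
  dist_comm x y := edgeLength_comm (T := T) x y
  dist_triangle x y z := edgeLength_triangle (T := T) x y z

noncomputable instance : MulAction Gᵐᵒᵖ (PreCollapse E) :=
  inferInstanceAs (MulAction Gᵐᵒᵖ T.carrier)

instance : IsIsometricSMul Gᵐᵒᵖ (PreCollapse E) where
  isometry_smul g := Isometry.of_dist_eq fun x y => edgeLength_smul (T := T) x y g.unop

/-- The underlying space of the collapsed tree. -/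
abbrev CollapsedSpace : Type u := SeparationQuotient (PreCollapse E)

/-- The identity map to the type synonym. -/
def toPreCollapse (x : T) : PreCollapse E := x

/-- The collapse map. -/
noncomputable def proj (x : T) : CollapsedSpace E := SeparationQuotient.mk (toPreCollapse E x)

end PreCollapse

section Collapse

variable {E : T.EdgeFamily}

theorem dist_proj (x y : T) : dist (proj E x) (proj E y) = edgeLength E x y := rfl

theorem proj_smul (x : T) (g : G) : proj E (x <• g) = proj E x <• g := rfl

theorem proj_surjective : Function.Surjective (proj E) :=
  SeparationQuotient.surjective_mk (X := PreCollapse E)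

theorem proj_eq_iff {x y : T} : proj E x = proj E y ↔ edgeLength E x y = 0 := by
  rw [← dist_eq_zero, dist_proj]

instance : IsIsometricSMul Gᵐᵒᵖ (CollapsedSpace E) where
  isometry_smul g := Isometry.of_dist_eq fun x y => by
    obtain ⟨x, rfl⟩ := proj_surjective x
    obtain ⟨y, rfl⟩ := proj_surjective y
    exact edgeLength_smul (T := T) x y g.unop

theorem proj_mem_metricSegment {x y p : T} (hp : p ∈ metricSegment x y) :
    proj E p ∈ metricSegment (proj E x) (proj E y) := by
  rw [mem_metricSegment, dist_proj, dist_proj, dist_proj]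
  exact edgeLength_add hp

theorem exists_mem_of_proj_mem {x y p : T}
    (hp : proj E p ∈ metricSegment (proj E x) (proj E y)) :
    ∃ m ∈ metricSegment x y, proj E m = proj E p := by
  obtain ⟨m, h1, h2, h3⟩ := T.isGeodesicTree.exists_median x y p
  refine ⟨m, h1, proj_eq_iff.2 ?_⟩
  rw [mem_metricSegment, dist_proj, dist_proj, dist_proj] at hp
  have a1 := edgeLength_add (E := E) h1
  have a2 := edgeLength_add (E := E) h2
  have a3 := edgeLength_add (E := E) h3
  have c1 := edgeLength_comm (E := E) y p
  have c2 := edgeLength_comm (E := E) y m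
  linarith

theorem collapsedSpace_isGeodesicTree (E : T.EdgeFamily) : IsGeodesicTree (CollapsedSpace E) where
  four_point x y z w := by
    obtain ⟨x, rfl⟩ := proj_surjective x
    obtain ⟨y, rfl⟩ := proj_surjective y
    obtain ⟨z, rfl⟩ := proj_surjective z
    obtain ⟨w, rfl⟩ := proj_surjective w
    exact edgeLength_four_point x y z w
  exists_dist_eq x y s h0 h1 := by
    obtain ⟨x, rfl⟩ := proj_surjective x
    obtain ⟨y, rfl⟩ := proj_surjective y
    obtain ⟨p, hp, hps⟩ := exists_edgeLength_eq x y h0 h1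
    refine ⟨proj E p, hps, ?_⟩
    rw [dist_proj, dist_proj, ← edgeLength_add hp, hps]
    ring

/-- The collapse map identifies an interior point of an edge of `E` with no other point. Such points
therefore keep their stabiliser and their regularity. -/
theorem eq_of_proj_eq {x y : T} {e : Set T} (he : e ∈ E.carrier) (hx : x ∈ e)
    (hxV : x ∉ T.vertices) (h : proj E y = proj E x) : y = x := by
  by_contra hne
  have := edgeLength_pos_of_mem he hx hxV hne
  rw [proj_eq_iff, edgeLength_comm] at h
  linarith

theorem eq_one_of_smul_proj_eq (hf : T.IsEdgeFree) {x : T} {e : Set T} (he : e ∈ E.carrier)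
    (hx : x ∈ e) (hxV : x ∉ T.vertices) {g : G} (h : proj E x <• g = proj E x) : g = 1 := by
  rw [← proj_smul] at h
  have hxg := eq_of_proj_eq he hx hxV h
  refine hf.edge_stabilizer e (E.subset_edges he) g ?_
  exact eq_of_mem_edges (smul_mem_edges (E.subset_edges he) g) (E.subset_edges he)
    (x := x <• g) ⟨x, hx, rfl⟩ (by rwa [hxg]) (by rwa [hxg])

theorem isRegularPoint_proj {x : T} {e : Set T} (he : e ∈ E.carrier) (hx : x ∈ e)
    (hxV : x ∉ T.vertices) : IsRegularPoint (proj E x) := by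
  have hreg : IsRegularPoint x := by_contra fun h => hxV (Or.inl h)
  obtain ⟨a, b, ha, hb, hab, hall⟩ := T.isGeodesicTree.isRegularPoint_iff.1 hreg
  have key : ∀ y z : T, x ∉ metricSegment y z →
      proj E x ∉ metricSegment (proj E y) (proj E z) := by
    intro y z hyz hcon
    obtain ⟨m, hm, hmx⟩ := exists_mem_of_proj_mem hcon
    exact hyz (eq_of_proj_eq he hx hxV hmx ▸ hm)
  refine (collapsedSpace_isGeodesicTree E).isRegularPoint_iff.2 ⟨proj E a, proj E b,
    fun h => ha (eq_of_proj_eq he hx hxV h), fun h => hb (eq_of_proj_eq he hx hxV h),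
    proj_mem_metricSegment hab, fun z hz => ?_⟩
  obtain ⟨z, rfl⟩ := proj_surjective z
  exact (hall z fun h => hz (h ▸ rfl)).imp (key a z) (key b z)

/-- Interior points of edges of `E` stay regular and have trivial stabiliser, so they are not
midpoints of inverted segments. All other points are identified with a vertex. -/
theorem vertexSet_collapsedSpace_subset (hm : T.IsMinimal) (hf : T.IsEdgeFree)
    (hV : T.vertices.Nonempty) (E : T.EdgeFamily) :
    vertexSet G (CollapsedSpace E) ⊆ proj E '' T.vertices := by
  intro y hy
  obtain ⟨x, rfl⟩ := proj_surjective y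
  by_cases hxV : x ∈ T.vertices
  · exact ⟨x, hxV, rfl⟩
  obtain ⟨v₀, hv₀⟩ := hV
  obtain ⟨v, w, hvw, hx⟩ := exists_isEdge hm hv₀ hxV
  by_cases hE : metricSegment v w ∈ E.carrier
  · exfalso
    rcases hy with hy | ⟨g, a, b, hab, h1, h2, h3, h4⟩
    · exact hy (isRegularPoint_proj hE hx hxV)
    · have h5 := (collapsedSpace_isGeodesicTree E).apply_midpoint_eq
        (IsometryEquiv.constSMul (MulOpposite.op g)) h1 h2 h3 h4
      have h6 := eq_one_of_smul_proj_eq hf hE hx hxV h5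
      rw [h6, MulOpposite.op_one, one_smul] at h1
      exact hab h1
  · exact ⟨v, hvw.left_mem, proj_eq_iff.2 (edgeLength_eq_zero_of_mem hvw.mem_edges hE
      (left_mem_metricSegment _ _) hx)⟩

theorem isDiscreteIn_vertexSet_collapsedSpace (hm : T.IsMinimal) (hf : T.IsEdgeFree)
    (hc : T.IsCocompact) (hV : T.vertices.Nonempty) (E : T.EdgeFamily) :
    IsDiscreteIn (vertexSet G (CollapsedSpace E)) := by
  intro y
  obtain ⟨x, rfl⟩ := proj_surjective y
  obtain ⟨ε, hε, hgap⟩ := hc.exists_edgeLength_gap_at hm E x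
  refine ⟨ε, hε, fun s hs hsx => ?_⟩
  obtain ⟨v, hv, rfl⟩ := vertexSet_collapsedSpace_subset hm hf hV E hs
  rw [dist_comm, dist_proj] at hsx
  exact (proj_eq_iff.2 ((hgap v hv).resolve_right (not_le.2 hsx))).symm

/-- The tree obtained by collapsing all edges outside `E`. -/
noncomputable abbrev collapse (hm : T.IsMinimal) (hf : T.IsEdgeFree) (hc : T.IsCocompact)
    (hV : T.vertices.Nonempty) (E : T.EdgeFamily) : GTree G where
  carrier := CollapsedSpace E
  isMetricSimplicialTree :=
    { isRTree :=
        haveI : Nonempty (CollapsedSpace E) := ⟨proj E (Classical.arbitrary T)⟩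
        (collapsedSpace_isGeodesicTree E).isRTree
      discrete := fun x => by
        obtain ⟨ε, hε, h⟩ := isDiscreteIn_vertexSet_collapsedSpace hm hf hc hV E x
        exact ⟨ε, hε, fun s hs => h s (Or.inl hs)⟩ }
  discrete_vertexSet := isDiscreteIn_vertexSet_collapsedSpace hm hf hc hV E

/-! ### The collapse and its elliptic subgroups -/

variable (hm : T.IsMinimal) (hf : T.IsEdgeFree) (hc : T.IsCocompact) (hV : T.vertices.Nonempty)

/-- The collapse map sends segments into segments, so preimages of connected sets are convex. This
gives both minimality and the absence of a global fixed point. -/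
theorem preimage_proj_eq_univ (hm : T.IsMinimal) (hf : T.IsEdgeFree) (hV : T.vertices.Nonempty)
    {F : Set (CollapsedSpace E)} (hF : IsConnected F)
    (hinv : ∀ (g : G), ∀ x ∈ F, x <• g ∈ F) : F = Set.univ := by
  have h : proj E ⁻¹' F = Set.univ := by
    refine eq_univ_of_convex hm hf hV (hF.nonempty.preimage proj_surjective)
      (fun g x hx => hinv g _ hx) fun x hx y hy p hp => ?_
    exact (collapsedSpace_isGeodesicTree E).metricSegment_subset_of_isPreconnected
      hF.isPreconnected hx hy (proj_mem_metricSegment hp)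
  refine Set.eq_univ_of_forall fun y => ?_
  obtain ⟨x, rfl⟩ := proj_surjective y
  exact (h ▸ Set.mem_univ x : x ∈ proj E ⁻¹' F)

theorem collapse_isMinimal : (T.collapse hm hf hc hV E).IsMinimal := by
  intro F _ hF hinv
  refine preimage_proj_eq_univ hm hf hV hF fun g x hx => ?_
  rw [← hinv g]
  exact ⟨x, hx, rfl⟩

theorem collapse_isCocompact : (T.collapse hm hf hc hV E).IsCocompact := by
  have hc' : CompactSpace (MulAction.orbitRel.Quotient Gᵐᵒᵖ T) := hc
  have hcont : Continuous (proj E) :=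
    (LipschitzWith.of_dist_le_mul (K := 1) fun x y => by
      rw [NNReal.coe_one, one_mul, dist_proj]; exact edgeLength_le_dist x y).continuous
  let φ : MulAction.orbitRel.Quotient Gᵐᵒᵖ T →
      MulAction.orbitRel.Quotient Gᵐᵒᵖ (CollapsedSpace E) :=
    Quotient.map' (proj E) (by
      rintro x y ⟨g, rfl⟩
      exact ⟨g, rfl⟩)
  have hφ : Continuous φ := hcont.quotient_map' _
  have hsurj : Function.Surjective φ := by
    intro q
    obtain ⟨y, rfl⟩ := Quotient.exists_rep q
    obtain ⟨x, rfl⟩ := proj_surjective y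
    exact ⟨Quotient.mk'' x, rfl⟩
  refine ⟨?_⟩
  have := isCompact_range hφ
  rwa [hsurj.range_eq] at this

theorem collapse_isEdgeFree (hE : E.carrier.Nonempty) :
    (T.collapse hm hf hc hV E).IsEdgeFree where
  edge_stabilizer := by
    intro e he g hg
    have ht := collapsedSpace_isGeodesicTree E
    obtain ⟨v, w, hvw, rfl⟩ := mem_edges_iff.1 he
    rw [smul_metricSegment] at hg
    have hv := hvw.eq_or_eq (v <• g) (hg ▸ left_mem_metricSegment _ _)
      (smul_mem_vertices hvw.left_mem g)
    have hw := hvw.eq_or_eq (w <• g) (hg ▸ right_mem_metricSegment _ _)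
      (smul_mem_vertices hvw.right_mem g)
    have hne : v <• g ≠ w <• g :=
      fun h => hvw.ne (((T.collapse hm hf hc hV E).translation g).injective h)
    rcases hv with hv | hv <;> rcases hw with hw | hw
    · exact absurd (hv.trans hw.symm) hne
    · obtain ⟨x, rfl⟩ := proj_surjective v
      obtain ⟨y, rfl⟩ := proj_surjective w
      have hpos : 0 < edgeLength E x y := dist_pos.2 hvw.ne
      obtain ⟨z, hz, hzV, e', he', hze⟩ := exists_mem_of_edgeLength_pos hpos
      refine eq_one_of_smul_proj_eq hf he' hze hzV (g := g) ?_
      have hz' := proj_mem_metricSegment (E := E) hz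
      have h1 : proj E z <• g ∈ metricSegment (proj E x <• g) (proj E y <• g) :=
        ((T.collapse hm hf hc hV E).translation g).mem_metricSegment_iff.2 hz'
      rw [hv, hw] at h1
      refine ht.eq_of_dist_eq h1 hz' ?_
      nth_rw 1 [← hv]
      exact dist_smul_eq (T := T.collapse hm hf hc hV E) _ _ g
    · exfalso
      obtain ⟨m, h1, h2⟩ := ht.exists_dist_eq v w (dist v w / 2) (by positivity)
        (by linarith [dist_nonneg (x := v) (y := w)])
      have hpos := dist_pos.2 hvw.ne
      -- An edge cannot be inverted, since its midpoint would then be a vertex in its interior.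
      have hmV : m ∈ (T.collapse hm hf hc hV E).vertices :=
        Or.inr ⟨g, v, w, hvw.ne, hv, hw, h1, by rw [h2]; ring⟩
      rcases hvw.eq_or_eq m (by rw [mem_metricSegment, h1, h2]; ring) hmV with rfl | rfl
      · rw [dist_self] at h1; linarith
      · rw [dist_self] at h2; linarith
    · exact absurd (hv.trans hw.symm) hne
  of_no_vertices := by
    intro hV'
    have ht := collapsedSpace_isGeodesicTree E
    obtain ⟨ε, hε, hgap⟩ := hc.exists_edgeLength_gap E
    have hreg : ∀ p : CollapsedSpace E, IsRegularPoint p := fun p => by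
      by_contra hp
      exact (hV' ▸ (Or.inl hp : p ∈ (T.collapse hm hf hc hV E).vertices) : p ∈ (∅ : Set _))
    refine ⟨ε, hε, fun g hg x => ?_⟩
    rcases ht.dist_apply_eq_or_reflection hreg ((T.collapse hm hf hc hV E).translation g) with
      h | ⟨p, a, h1, h2, h3, h4⟩
    -- All points move equally far, so it suffices to consider the image of a vertex of `T`, which
    -- moves by zero or by at least `ε`. Zero would make `g` fix an interior point of an edge of
    -- `E`.
    · obtain ⟨v, hv⟩ := hV
      have hvx := h (proj E v) x
      rcases hgap v hv (v <• g) (smul_mem_vertices hv g) with h5 | h5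
      · exfalso
        obtain ⟨e, he⟩ := hE
        obtain ⟨a, b, hab, rfl⟩ := mem_edges_iff.1 (E.subset_edges he)
        obtain ⟨z, hz, -, hzV⟩ := hab.exists_midpoint
        refine hg (eq_one_of_smul_proj_eq hf he hz hzV ?_)
        have h6 := h (proj E v) (proj E z)
        exact (dist_eq_zero.1 (h6.symm.trans h5)).symm
      · exact h5.trans hvx.le
    · exfalso
      exact (hV' ▸ (Or.inr ⟨g, a, _, h1, rfl, h2, h3, h4⟩ :
        p ∈ (T.collapse hm hf hc hV E).vertices) : p ∈ (∅ : Set _))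

theorem mem_ellipticSubgroups_collapse {H : Subgroup G} :
    H ∈ (T.collapse hm hf hc hV E).ellipticSubgroups ↔
      ∃ x : T, ∀ g ∈ H, edgeLength E x (x <• g) = 0 := by
  constructor
  · rintro ⟨y, hy⟩
    obtain ⟨x, rfl⟩ := proj_surjective (E := E) y
    exact ⟨x, fun g hg => proj_eq_iff.1 (hy g hg).symm⟩
  · rintro ⟨x, hx⟩
    exact ⟨proj E x, fun g hg => (proj_eq_iff.2 (hx g hg)).symm⟩

theorem ellipticSubgroups_subset_collapse :
    T.ellipticSubgroups ⊆ (T.collapse hm hf hc hV E).ellipticSubgroups := by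
  rintro H ⟨x, hx⟩
  exact ⟨proj E x, fun g hg => congrArg (proj E) (hx g hg)⟩

theorem top_not_mem_ellipticSubgroups_collapse (hE : E.carrier.Nonempty) :
    ⊤ ∉ (T.collapse hm hf hc hV E).ellipticSubgroups := by
  rintro ⟨y, hy⟩
  have h : ({y} : Set (CollapsedSpace E)) = Set.univ :=
    preimage_proj_eq_univ hm hf hV isConnected_singleton fun g x hx => by
      rw [Set.mem_singleton_iff.1 hx]
      exact hy g trivial
  obtain ⟨e, he⟩ := hE
  obtain ⟨a, b, hab, rfl⟩ := mem_edges_iff.1 (E.subset_edges he)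
  have ha : proj E a ∈ ({y} : Set (CollapsedSpace E)) := h ▸ Set.mem_univ _
  have hb : proj E b ∈ ({y} : Set (CollapsedSpace E)) := h ▸ Set.mem_univ _
  have h1 := proj_eq_iff.1 (Eq.trans ha (Eq.symm hb))
  rw [edgeLength_eq_dist (Set.subset_sUnion_of_mem he)] at h1
  exact hab.ne (dist_eq_zero.1 h1)

theorem isInvariantUnder_ellipticSubgroups_collapse {α : MulAut G} {f : T ≃ᵢ T}
    (hα : ∀ (x : T) (g : G), f (x <• g) = f x <• α g)
    (hfE : f '' ⋃₀ E.carrier = ⋃₀ E.carrier) :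
    IsInvariantUnder (T.collapse hm hf hc hV E).ellipticSubgroups α := by
  apply Set.Subset.antisymm
  · rintro _ ⟨H, hH, rfl⟩
    obtain ⟨x, hx⟩ := (mem_ellipticSubgroups_collapse hm hf hc hV).1 hH
    refine (mem_ellipticSubgroups_collapse hm hf hc hV).2 ⟨f x, ?_⟩
    rintro _ ⟨g, hg, rfl⟩
    have h1 := edgeLength_apply f hfE x (x <• g)
    rw [hα, hx g hg] at h1
    exact h1
  · intro K hK
    obtain ⟨y, hy⟩ := (mem_ellipticSubgroups_collapse hm hf hc hV).1 hK
    obtain ⟨x, rfl⟩ := f.surjective y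
    refine ⟨K.comap α.toMonoidHom, (mem_ellipticSubgroups_collapse hm hf hc hV).2 ⟨x, ?_⟩,
      Subgroup.map_comap_eq_self_of_surjective α.surjective K⟩
    intro g hg
    rw [← edgeLength_apply f hfE, hα]
    exact hy _ hg

end Collapse

end GTree

namespace GTree

variable {G : Type u} [Group G] {T : GTree G}

/-! ### Vertices incident to a single edge of a collapsed family -/

/-- The stabiliser of the component of the union of the edges outside `E` containing `x`. -/
def componentStabilizer (E : T.EdgeFamily) (x : T) : Subgroup G where
  carrier := {g | edgeLength E x (x <• g) = 0}
  one_mem' := by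
    rw [Set.mem_ofPred_eq, smul_one_eq, edgeLength_self]
  mul_mem' {g k} hg hk := by
    rw [Set.mem_ofPred_eq] at *
    have h1 := edgeLength_triangle (E := E) x (x <• k) (x <• (g * k))
    rw [← smul_smul_eq, edgeLength_smul, hg, hk] at h1
    rw [← smul_smul_eq]
    linarith [edgeLength_nonneg (E := E) x (x <• g <• k)]
  inv_mem' {g} hg := by
    rw [Set.mem_ofPred_eq] at *
    rw [← edgeLength_smul _ _ g, inv_smul_smul_eq, edgeLength_comm]
    exact hg

/-- Here irreducibility enters: by maximality the elliptic subgroups of the collapse already lie in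
`𝒢`, and the stabiliser of the component of `x` is one of them. -/
theorem exists_fixed_point {𝒢 : Set (Subgroup G)} {α : MulAut G} (hirr : IsIrreducibleAut 𝒢 α)
    (hT : T ∈ deformationSpace 𝒢) {f : T ≃ᵢ T} (hα : ∀ (x : T) (g : G), f (x <• g) = f x <• α g)
    {E : T.EdgeFamily} (hE : E.carrier.Nonempty) (hfE : f '' ⋃₀ E.carrier = ⋃₀ E.carrier) (x : T) :
    ∃ p : T, ∀ g : G, edgeLength E x (x <• g) = 0 → p <• g = p := by
  obtain ⟨hm, hc, hf, rfl⟩ := hT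
  have hV : T.vertices.Nonempty := by
    obtain ⟨e, he⟩ := hE
    obtain ⟨v, w, hvw, -⟩ := mem_edges_iff.1 (E.subset_edges he)
    exact ⟨v, hvw.left_mem⟩
  have hle := hirr.le_of_ge (y := (T.collapse hm hf hc hV E).ellipticSubgroups)
    ⟨⟨_, collapse_isMinimal hm hf hc hV, collapse_isCocompact hm hf hc hV,
      collapse_isEdgeFree hm hf hc hV hE, rfl⟩,
      top_not_mem_ellipticSubgroups_collapse hm hf hc hV hE,
      isInvariantUnder_ellipticSubgroups_collapse hm hf hc hV hα hfE⟩
    (ellipticSubgroups_subset_collapse hm hf hc hV)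
  exact hle (a := componentStabilizer E x)
    ((mem_ellipticSubgroups_collapse hm hf hc hV).2 ⟨x, fun _ hg => hg⟩)

theorem exists_isEdge_eq_of_mem {e : Set T} (he : e ∈ T.edges) {v : T} (hv : v ∈ T.vertices)
    (hve : v ∈ e) : ∃ w, T.IsEdge v w ∧ e = metricSegment v w := by
  obtain ⟨a, b, hab, rfl⟩ := mem_edges_iff.1 he
  rcases hab.eq_or_eq v hve hv with rfl | rfl
  · exact ⟨b, hab, rfl⟩
  · exact ⟨a, hab.symm, metricSegment_comm _ _⟩

/-- In the component of an end of `e₀`, choose a vertex on an edge outside `E` at maximal distance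
from the fixed point `p` of the component stabiliser. Every edge outside `E` at this vertex must
lead towards `p`, so there is only one. -/
theorem exists_vertex_unique_edge (hf : T.IsEdgeFree) (hc : T.IsCocompact) {E : T.EdgeFamily}
    (hfix : ∀ x : T, ∃ p : T, ∀ g : G, edgeLength E x (x <• g) = 0 → p <• g = p)
    {e₀ : Set T} (he₀ : e₀ ∈ T.edges) (heE : e₀ ∉ E.carrier) :
    ∃ v ∈ T.vertices, ∃ e ∈ T.edges, e ∉ E.carrier ∧ v ∈ e ∧
      (∀ e' ∈ T.edges, e' ∉ E.carrier → v ∈ e' → e' = e) ∧ ∀ g : G, v <• g = v → g = 1 := by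
  have ht := T.isGeodesicTree
  obtain ⟨a, b, hab, rfl⟩ := mem_edges_iff.1 he₀
  obtain ⟨p, hp⟩ := hfix a
  set S : Set T := {v | v ∈ T.vertices ∧ edgeLength E a v = 0 ∧
    ∃ e ∈ T.edges, e ∉ E.carrier ∧ v ∈ e} with hS
  obtain ⟨ε, hε, hsep⟩ := hc.exists_separation
  obtain ⟨s, hs, hrep⟩ := hc.exists_finite_representatives hε
    (fun g v hv => smul_mem_vertices hv g) hsep
  -- Two vertices of `S` in the same `G`-orbit differ by an element stabilising the component. It
  -- fixes `p`, so both have the same distance from `p`, and there are finitely many orbits of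
  -- vertices.
  have hfin : ((fun v => dist p v) '' S).Finite := by
    refine (hs.biUnion (t := fun r => {d | ∃ v ∈ S, ∃ g : G, v <• g = r ∧ d = dist p v})
      fun r _ => Set.Subsingleton.finite ?_).subset ?_
    · rintro _ ⟨v, hv, g, rfl, rfl⟩ _ ⟨w, hw, k, hk, rfl⟩
      have hw' : w = v <• (g * k⁻¹) := by
        rw [← smul_smul_eq, ← hk, smul_inv_smul_eq]
      have hak : edgeLength E a (a <• (g * k⁻¹)) = 0 := by
        have h1 := edgeLength_triangle (E := E) a w (a <• (g * k⁻¹))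
        rw [hw.2.1, hw', edgeLength_smul, edgeLength_comm v a, hv.2.1] at h1
        linarith [edgeLength_nonneg (E := E) a (a <• (g * k⁻¹))]
      rw [hw', ← dist_smul_eq p v (g * k⁻¹), hp _ hak]
    · rintro _ ⟨v, hv, rfl⟩
      obtain ⟨g, hg⟩ := hrep v hv.1
      exact Set.mem_iUnion₂.2 ⟨_, hg, v, hv, g, rfl, rfl⟩
  have haS : a ∈ S := ⟨hab.left_mem, edgeLength_self a, _, he₀, heE, left_mem_metricSegment _ _⟩
  obtain ⟨_, ⟨v, ⟨hvV, hav, e, he, heE', hve⟩, rfl⟩, hmax⟩ :=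
    Set.exists_max_image _ id hfin ⟨_, a, haS, rfl⟩
  have hfar : ∀ c, T.IsEdge v c → metricSegment v c ∉ E.carrier → v ∉ metricSegment c p := by
    intro c hvc hcE hcp
    have hcS : c ∈ S := by
      refine ⟨hvc.right_mem, ?_, _, hvc.mem_edges, hcE, right_mem_metricSegment _ _⟩
      have h1 := edgeLength_triangle (E := E) a v c
      rw [hav, hvc.edgeLength_eq_zero hcE] at h1
      linarith [edgeLength_nonneg (E := E) a c]
    have h2 : dist p c ≤ dist p v := hmax _ ⟨c, hcS, rfl⟩
    rw [mem_metricSegment] at hcp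
    linarith [dist_pos.2 hvc.ne, dist_comm v c, dist_comm p c, dist_comm p v]
  obtain ⟨c, hvc, rfl⟩ := exists_isEdge_eq_of_mem he hvV hve
  have huniq : ∀ e' ∈ T.edges, e' ∉ E.carrier → v ∈ e' → e' = metricSegment v c := by
    intro e' he' heE'' hve'
    by_contra hne
    obtain ⟨c', hvc', rfl⟩ := exists_isEdge_eq_of_mem he' hvV hve'
    rcases ht.mem_or (hvc.mem_of_ne hvc' (Ne.symm hne)) p with h | h
    · exact hfar c hvc heE' h
    · exact hfar c' hvc' heE'' h
  refine ⟨v, hvV, _, he, heE', hve, huniq, fun g hg => hf.edge_stabilizer _ he g ?_⟩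
  refine huniq _ (smul_mem_edges he g) (fun h => heE' ?_) ⟨v, hve, hg⟩
  have h1 := E.smul_mem _ h g⁻¹
  rwa [smul_smul, ← MulOpposite.op_mul, mul_inv_cancel, MulOpposite.op_one, one_smul] at h1

/-! ### Transitivity on edges -/

section Transitivity

/-- The group of symmetries of `T`. -/
def symmetryGroup (T : GTree G) : Subgroup (T ≃ᵢ T) where
  carrier := {h | T.IsSymmetry h}
  one_mem' := ⟨1, fun _ _ => rfl⟩
  mul_mem' hh hk := hh.mul hk
  inv_mem' hh := hh.symm

variable {Γ : Subgroup (T ≃ᵢ T)}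

/-- The orbit of an edge under a group of isometries. -/
def edgeSetOrbit (Γ : Subgroup (T ≃ᵢ T)) (e : Set T) : Set (Set T) := {e' | ∃ h ∈ Γ, h '' e = e'}

theorem image_mul (h k : T ≃ᵢ T) (A : Set T) : (h * k) '' A = h '' (k '' A) := by
  rw [IsometryEquiv.coe_mul, Set.image_comp]

theorem inv_image_image (h : T ≃ᵢ T) (A : Set T) : ⇑(h⁻¹) '' (h '' A) = A := by
  rw [← image_mul, inv_mul_cancel, IsometryEquiv.coe_one, Set.image_id]

theorem image_mem_edgeSetOrbit_iff {h : T ≃ᵢ T} (hh : h ∈ Γ) {e e' : Set T} :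
    h '' e' ∈ edgeSetOrbit Γ e ↔ e' ∈ edgeSetOrbit Γ e := by
  constructor
  · rintro ⟨k, hk, hke⟩
    refine ⟨h⁻¹ * k, Γ.mul_mem (Γ.inv_mem hh) hk, ?_⟩
    rw [image_mul, hke, inv_image_image]
  · rintro ⟨k, hk, rfl⟩
    exact ⟨h * k, Γ.mul_mem hh hk, image_mul _ _ _⟩

theorem mem_edgeSetOrbit_self (Γ : Subgroup (T ≃ᵢ T)) (e : Set T) : e ∈ edgeSetOrbit Γ e :=
  ⟨1, Γ.one_mem, Set.image_id e⟩

/-- The `G`-invariant family of edges in an orbit of a larger group. -/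
def orbitFamily (hΓ : Γ ≤ T.symmetryGroup) (htr : ∀ g : G, T.translation g ∈ Γ) {e : Set T}
    (he : e ∈ T.edges) : T.EdgeFamily where
  carrier := edgeSetOrbit Γ e
  subset_edges := by
    rintro _ ⟨h, hh, rfl⟩
    exact (hΓ hh).image_mem_edges he
  smul_mem e' he' g := (image_mem_edgeSetOrbit_iff (htr g)).2 he'

/-- The `G`-invariant family of edges outside an orbit of a larger group. -/
def orbitComplFamily (htr : ∀ g : G, T.translation g ∈ Γ) (e : Set T) : T.EdgeFamily where
  carrier := T.edges \ edgeSetOrbit Γ e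
  subset_edges := Set.sdiff_subset
  smul_mem _ he' g := ⟨smul_mem_edges he'.1 g,
    fun h => he'.2 ((image_mem_edgeSetOrbit_iff (htr g)).1 h)⟩

/-- The `G`-orbits of edges contained in the orbit of `e`. -/
def orbitClasses (Γ : Subgroup (T ≃ᵢ T)) (e : Set T) : Set T.EdgeOrbit :=
  {q | ∃ d : T.edges, (d : Set T) ∈ edgeSetOrbit Γ e ∧ T.edgeOrbit d = q}

/-- The descent step: `e'` is the single edge outside `Γe` at a suitable vertex `v`, and the
`G`-classes in `Γe` map onto those in `Γe'` without being mapped injectively. -/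
theorem exists_orbitClasses_ncard_lt (hm : T.IsMinimal) (hf : T.IsEdgeFree) (hc : T.IsCocompact)
    (hΓ : Γ ≤ T.symmetryGroup) (htr : ∀ g : G, T.translation g ∈ Γ)
    (hfix : ∀ E : T.EdgeFamily, E.carrier.Nonempty →
      (∀ h ∈ Γ, ∀ e ∈ E.carrier, h '' e ∈ E.carrier) →
      ∀ x : T, ∃ p : T, ∀ g : G, edgeLength E x (x <• g) = 0 → p <• g = p)
    {e d : Set T} (he : e ∈ T.edges) (hd : d ∈ T.edges) (hde : d ∉ edgeSetOrbit Γ e) :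
    ∃ e' ∈ T.edges, (orbitClasses Γ e').ncard < (orbitClasses Γ e).ncard := by
  obtain ⟨v, hvV, e', he', he'O, hve', hv, hstab⟩ := exists_vertex_unique_edge hf hc
    (E := orbitFamily hΓ htr he) (hfix _ ⟨e, mem_edgeSetOrbit_self Γ e⟩
      fun h hh k hk => (image_mem_edgeSetOrbit_iff hh).2 hk) hd hde
  -- The same argument with the roles of the orbit and its complement exchanged.
  obtain ⟨u, huV, c, hc', hcO, huc, hu, -⟩ := exists_vertex_unique_edge hf hc
    (E := orbitComplFamily htr e) (hfix _ ⟨d, hd, hde⟩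
      fun h hh k hk => ⟨(hΓ hh).image_mem_edges hk.1,
        fun h' => hk.2 ((image_mem_edgeSetOrbit_iff hh).1 h')⟩) he
      (fun h => h.2 (mem_edgeSetOrbit_self Γ e))
  replace hcO : c ∈ edgeSetOrbit Γ e := by_contra fun h => hcO ⟨hc', h⟩
  replace hu : ∀ k ∈ edgeSetOrbit Γ e, u ∈ k → k = c := fun k hk huk =>
    hu k ((orbitFamily hΓ htr he).subset_edges hk) (fun h => h.2 hk) huk
  have hesub : ∀ k ∈ edgeSetOrbit Γ e, k ∈ T.edges := (orbitFamily hΓ htr he).subset_edges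
  obtain ⟨x, -, -, hxV⟩ := (mem_edges_iff.1 he).choose_spec.choose_spec.1.exists_midpoint
  -- Of at least three edges at `v`, only one is outside the orbit.
  have htwo : ∃ e₁ ∈ edgeSetOrbit Γ e, ∃ e₂ ∈ edgeSetOrbit Γ e, v ∈ e₁ ∧ v ∈ e₂ ∧ e₁ ≠ e₂ := by
    obtain ⟨a₁, ha₁, a₂, ha₂, a₃, ha₃, hv₁, hv₂, hv₃, h12, h13, h23⟩ :=
      exists_three_edges hm hf hvV hxV hstab
    by_cases h1 : a₁ ∈ edgeSetOrbit Γ e <;> by_cases h2 : a₂ ∈ edgeSetOrbit Γ e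
    · exact ⟨a₁, h1, a₂, h2, hv₁, hv₂, h12⟩
    · have h3 : a₃ ∈ edgeSetOrbit Γ e := by_contra fun h3 =>
        h23 ((hv a₂ ha₂ h2 hv₂).trans (hv a₃ ha₃ h3 hv₃).symm)
      exact ⟨a₁, h1, a₃, h3, hv₁, hv₃, h13⟩
    · have h3 : a₃ ∈ edgeSetOrbit Γ e := by_contra fun h3 =>
        h13 ((hv a₁ ha₁ h1 hv₁).trans (hv a₃ ha₃ h3 hv₃).symm)
      exact ⟨a₂, h2, a₃, h3, hv₂, hv₃, h23⟩
    · exact absurd ((hv a₁ ha₁ h1 hv₁).trans (hv a₂ ha₂ h2 hv₂).symm) h12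
  obtain ⟨e₁, he₁, e₂, he₂, hv₁, hv₂, h12⟩ := htwo
  -- translates of `v` and `u` are different
  have hvu : ∀ h ∈ Γ, ∀ l ∈ Γ, h v ≠ l u := by
    intro h hh l hl heq
    have hul : l⁻¹ (h v) = u := by rw [heq, IsometryEquiv.inv_apply_self]
    have key : ∀ k ∈ edgeSetOrbit Γ e, v ∈ k → (l⁻¹ * h) '' k = c := fun k hk hvk =>
      hu _ ((image_mem_edgeSetOrbit_iff (Γ.mul_mem (Γ.inv_mem hl) hh)).2 hk) ⟨v, hvk, hul⟩
    exact h12 ((l⁻¹ * h).injective.image_injective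
      ((key e₁ he₁ hv₁).trans (key e₂ he₂ hv₂).symm))
  -- an edge of the orbit contains at most one translate of `v`
  have hone : ∀ k ∈ edgeSetOrbit Γ e, ∀ h₁ ∈ Γ, ∀ h₂ ∈ Γ, h₁ v ∈ k → h₂ v ∈ k →
      h₁ v = h₂ v := by
    intro k hk h₁ hh₁ h₂ hh₂ hk₁ hk₂
    obtain ⟨l, hl, rfl⟩ : ∃ l ∈ Γ, l '' c = k := by
      obtain ⟨l₁, hl₁, rfl⟩ := hk
      obtain ⟨l₂, hl₂, rfl⟩ := hcO
      refine ⟨l₁ * l₂⁻¹, Γ.mul_mem hl₁ (Γ.inv_mem hl₂), ?_⟩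
      rw [image_mul, inv_image_image]
    obtain ⟨w, hw, hkw⟩ := exists_isEdge_eq_of_mem (hesub _ hk)
      ((hΓ hl).apply_mem_vertices huV) ⟨u, huc, rfl⟩
    rw [hkw] at hk₁ hk₂
    have h1 := (hw.eq_or_eq _ hk₁ ((hΓ hh₁).apply_mem_vertices hvV)).resolve_left
      (hvu h₁ hh₁ l hl)
    have h2 := (hw.eq_or_eq _ hk₂ ((hΓ hh₂).apply_mem_vertices hvV)).resolve_left
      (hvu h₂ hh₂ l hl)
    rw [h1, h2]
  -- the edge outside the orbit is determined by the translate of `v`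
  have hout : ∀ h₁ ∈ Γ, ∀ h₂ ∈ Γ, h₁ v = h₂ v → h₁ '' e' = h₂ '' e' := by
    intro h₁ hh₁ h₂ hh₂ heq
    have h3 : (h₂⁻¹ * h₁) '' e' = e' := by
      have hmem := Γ.mul_mem (Γ.inv_mem hh₂) hh₁
      refine hv _ ((hΓ hmem).image_mem_edges he')
        (fun h => he'O ((image_mem_edgeSetOrbit_iff hmem).1 h)) ⟨v, hve', ?_⟩
      rw [IsometryEquiv.mul_apply, heq, IsometryEquiv.inv_apply_self]
    nth_rw 2 [← h3]
    rw [← image_mul, mul_inv_cancel_left]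
  have himg : ∀ h ∈ Γ, h '' e' ∈ T.edges := fun h hh => (hΓ hh).image_mem_edges he'
  have key : ∀ (k₁ k₂ : T.edges) (h₁ h₂ : T ≃ᵢ T) (hh₁ : h₁ ∈ Γ) (hh₂ : h₂ ∈ Γ),
      (k₁ : Set T) ∈ edgeSetOrbit Γ e → h₁ v ∈ (k₁ : Set T) → h₂ v ∈ (k₂ : Set T) →
      T.edgeOrbit k₁ = T.edgeOrbit k₂ →
      T.edgeOrbit ⟨h₁ '' e', himg h₁ hh₁⟩ = T.edgeOrbit ⟨h₂ '' e', himg h₂ hh₂⟩ := by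
    intro k₁ k₂ h₁ h₂ hh₁ hh₂ hk₁ hv₁ hv₂ hk
    obtain ⟨g, hg⟩ := edgeOrbit_eq_iff.1 hk
    refine edgeOrbit_eq_iff.2 ⟨g, ?_⟩
    have hmem := Γ.mul_mem (htr g) hh₂
    have h3 := hout _ hmem _ hh₁ (hone _ hk₁ _ hmem _ hh₁ (hg ▸ ⟨_, hv₂, rfl⟩) hv₁)
    rwa [image_mul, image_translation] at h3
  -- `Ψ` sends the class of an edge of the orbit to the class of the outside edge at its translate
  -- of `v`; by `key` this does not depend on choices. Elsewhere its value is irrelevant.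
  have hΨ : ∀ q : T.EdgeOrbit, ∃ r : T.EdgeOrbit, q ∈ orbitClasses Γ e →
      ∃ (k : T.edges) (h : T ≃ᵢ T) (hh : h ∈ Γ), (k : Set T) ∈ edgeSetOrbit Γ e ∧
        T.edgeOrbit k = q ∧ h v ∈ (k : Set T) ∧ r = T.edgeOrbit ⟨h '' e', himg h hh⟩ := by
    intro q
    by_cases hq : q ∈ orbitClasses Γ e
    · obtain ⟨k, hk, hkq⟩ := hq
      obtain ⟨h, hh, hhk⟩ : ∃ h ∈ Γ, h '' e₁ = k := by
        obtain ⟨l₁, hl₁, hlk⟩ := hk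
        obtain ⟨l₂, hl₂, rfl⟩ := he₁
        refine ⟨l₁ * l₂⁻¹, Γ.mul_mem hl₁ (Γ.inv_mem hl₂), ?_⟩
        rw [image_mul, inv_image_image, hlk]
      have hvk : h v ∈ (k : Set T) := hhk ▸ Set.mem_image_of_mem h hv₁
      exact ⟨T.edgeOrbit ⟨h '' e', himg h hh⟩, fun _ => ⟨k, h, hh, hk, hkq, hvk, rfl⟩⟩
    · exact ⟨q, fun h => absurd h hq⟩
  choose Ψ hΨ using hΨ
  have := hc.finite_edgeOrbit
  refine ⟨e', he', ?_⟩
  have hsub : orbitClasses Γ e' ⊆ Ψ '' orbitClasses Γ e := by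
    rintro _ ⟨⟨_, hk⟩, ⟨h, hh, rfl⟩, rfl⟩
    have hmem : h '' e₁ ∈ edgeSetOrbit Γ e := (image_mem_edgeSetOrbit_iff hh).2 he₁
    have hq : T.edgeOrbit ⟨h '' e₁, hesub _ hmem⟩ ∈ orbitClasses Γ e := ⟨_, hmem, rfl⟩
    obtain ⟨k, l, hl, hkO, hkq, hvk, hr⟩ := hΨ _ hq
    refine ⟨_, hq, ?_⟩
    rw [hr]
    exact key k ⟨h '' e₁, hesub _ hmem⟩ l h hl hh hkO hvk (Set.mem_image_of_mem h hv₁) hkq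
  have hlt : (Ψ '' orbitClasses Γ e).ncard < (orbitClasses Γ e).ncard := by
    refine lt_of_le_of_ne (Set.ncard_image_le (Set.toFinite _)) fun heq => ?_
    have hinj := Set.injOn_of_ncard_image_eq heq (Set.toFinite _)
    have hq₁ : T.edgeOrbit ⟨e₁, hesub _ he₁⟩ ∈ orbitClasses Γ e := ⟨_, he₁, rfl⟩
    have hq₂ : T.edgeOrbit ⟨e₂, hesub _ he₂⟩ ∈ orbitClasses Γ e := ⟨_, he₂, rfl⟩
    -- Both `e₁` and `e₂` contain `v`, so both classes are sent to that of `e'`. Injectivity would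
    -- give `g` carrying `e₂` to `e₁`; such a `g` fixes `v`, hence is trivial.
    have hqq := hinj hq₁ hq₂ (by
      obtain ⟨k₁, l₁, hl₁, hk₁, hkq₁, hvk₁, hr₁⟩ := hΨ _ hq₁
      obtain ⟨k₂, l₂, hl₂, hk₂, hkq₂, hvk₂, hr₂⟩ := hΨ _ hq₂
      rw [hr₁, hr₂]
      exact (key k₁ _ l₁ 1 hl₁ Γ.one_mem hk₁ hvk₁ hv₁ hkq₁).trans
        (key k₂ _ l₂ 1 hl₂ Γ.one_mem hk₂ hvk₂ hv₂ hkq₂).symm)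
    obtain ⟨g, hg⟩ := edgeOrbit_eq_iff.1 hqq
    have hvg : v <• g = v := hone _ he₁ _ (htr g) 1 Γ.one_mem (hg.subset ⟨v, hv₂, rfl⟩) hv₁
    rw [hstab g hvg, MulOpposite.op_one, one_smul] at hg
    exact h12 hg.symm
  exact (Set.ncard_le_ncard hsub (Set.toFinite _)).trans_lt hlt

theorem mem_edgeSetOrbit_of_fixed_points (hm : T.IsMinimal) (hf : T.IsEdgeFree)
    (hc : T.IsCocompact) (hΓ : Γ ≤ T.symmetryGroup) (htr : ∀ g : G, T.translation g ∈ Γ)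
    (hfix : ∀ E : T.EdgeFamily, E.carrier.Nonempty →
      (∀ h ∈ Γ, ∀ e ∈ E.carrier, h '' e ∈ E.carrier) →
      ∀ x : T, ∃ p : T, ∀ g : G, edgeLength E x (x <• g) = 0 → p <• g = p)
    {e d : Set T} (he : e ∈ T.edges) (hd : d ∈ T.edges) : d ∈ edgeSetOrbit Γ e := by
  by_contra hde
  -- If one orbit contained all edges, `d` would lie in the orbit of `e`. So the descent step
  -- applies to every orbit and never stops.
  have hne : ∀ k : Set T, ∃ d' ∈ T.edges, d' ∉ edgeSetOrbit Γ k := by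
    intro k
    by_contra! hcon
    obtain ⟨l₁, hl₁, rfl⟩ := hcon e he
    obtain ⟨l₂, hl₂, rfl⟩ := hcon d hd
    refine hde ⟨l₂ * l₁⁻¹, Γ.mul_mem hl₂ (Γ.inv_mem hl₁), ?_⟩
    rw [image_mul, inv_image_image]
  have hall : ∀ n : ℕ, ∀ k ∈ T.edges, (orbitClasses Γ k).ncard = n → False := by
    intro n
    induction n using Nat.strong_induction_on with
    | _ n ih =>
      rintro k hk rfl
      obtain ⟨d', hd', hdk⟩ := hne k
      obtain ⟨k', hk', hlt⟩ := exists_orbitClasses_ncard_lt hm hf hc hΓ htr hfix hk hd' hdk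
      exact ih _ hlt k' hk' rfl
  exact hall _ e he rfl

end Transitivity

/-! ### The induced permutation of edge orbits -/

/-- The map on `G`-orbits of edges induced by a symmetry. -/
def IsSymmetry.edgeOrbitMap {h : T ≃ᵢ T} (hh : T.IsSymmetry h) : T.EdgeOrbit → T.EdgeOrbit :=
  Quotient.lift (fun e : T.edges => T.edgeOrbit ⟨h '' (e : Set T), hh.image_mem_edges e.2⟩) (by
    intro e e' hee
    obtain ⟨β, hβ⟩ := hh
    obtain ⟨g, hg⟩ := edgeOrbit_eq_iff.1 (Quotient.sound hee : T.edgeOrbit e = T.edgeOrbit e')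
    refine edgeOrbit_eq_iff.2 ⟨β g, ?_⟩
    change (fun x => x <• β g) '' (h '' (e' : Set T)) = h '' (e : Set T)
    rw [← hg]
    change _ = h '' ((fun x => x <• g) '' (e' : Set T))
    rw [Set.image_image, Set.image_image]
    simp only [hβ])

/-- The permutation of the `G`-orbits of edges induced by a symmetry. -/
def IsSymmetry.edgeOrbitPerm {h : T ≃ᵢ T} (hh : T.IsSymmetry h) : Equiv.Perm T.EdgeOrbit where
  toFun := hh.edgeOrbitMap
  invFun := hh.symm.edgeOrbitMap
  left_inv q := by
    obtain ⟨e, rfl⟩ := Quotient.exists_rep q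
    exact congrArg T.edgeOrbit (Subtype.ext (inv_image_image h e))
  right_inv q := by
    obtain ⟨e, rfl⟩ := Quotient.exists_rep q
    exact congrArg T.edgeOrbit (Subtype.ext (inv_image_image h⁻¹ e))

end GTree

/-! ### From transitivity on edges to a cyclic permutation of edge orbits -/

theorem mainTheorem2 {G : Type u} [Group G] (𝒢 : Set (Subgroup G)) (h𝒢 : IsFreeFactorSystem 𝒢)
    (α : MulAut G) (hα : IsInvariantUnder 𝒢 α) (hirr : IsIrreducibleAut 𝒢 α)
    (hdisp : displacement 𝒢 α = 1) (T : GTree G) (hT : T ∈ minDisplaced 𝒢 α)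
    (f : GTree.EquivariantIsometry T (T.twist α)) :
    ∃ φ : Equiv.Perm T.EdgeOrbit,
      (∀ e : T.edges, ∃ h : f.toFun '' (e : Set T) ∈ T.edges,
        φ (T.edgeOrbit e) = T.edgeOrbit ⟨f.toFun '' (e : Set T), h⟩) ∧
      φ.IsCycleOn Set.univ := by
  let k : T ≃ᵢ T := f.toIsometryEquiv
  have hk : ∀ (x : T) (g : G), k (x <• g) = k x <• α g := fun x g => f.equivariant x g
  have hks : T.IsSymmetry k := ⟨α, hk⟩
  refine ⟨hks.edgeOrbitPerm, fun e => ⟨hks.image_mem_edges e.2, rfl⟩,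
    Set.bijOn_univ.2 hks.edgeOrbitPerm.bijective, ?_⟩
  set Γ : Subgroup (T ≃ᵢ T) := Subgroup.closure (insert k (Set.range T.translation)) with hΓdef
  have hkΓ : k ∈ Γ := Subgroup.subset_closure (Set.mem_insert _ _)
  have htr : ∀ g : G, T.translation g ∈ Γ := fun g =>
    Subgroup.subset_closure (Set.mem_insert_of_mem _ ⟨g, rfl⟩)
  have hΓ : Γ ≤ T.symmetryGroup := by
    rw [hΓdef, Subgroup.closure_le]
    rintro _ (rfl | ⟨g, rfl⟩)
    · exact hks
    · exact T.isSymmetry_translation g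
  -- Generators of `Γ` move the class of an edge by the permutation once (`k`) or not at all
  -- (translations), so `Γ` preserves its cycles.
  have hcycle : ∀ h ∈ Γ, ∀ (e : T.edges) (he : h '' (e : Set T) ∈ T.edges),
      hks.edgeOrbitPerm.SameCycle (T.edgeOrbit e) (T.edgeOrbit ⟨h '' (e : Set T), he⟩) := by
    intro h hh
    induction hh using Subgroup.closure_induction with
    | mem h hh =>
      intro e he
      rcases hh with rfl | ⟨g, rfl⟩
      · exact ⟨1, rfl⟩
      · exact ⟨0, (GTree.edgeOrbit_eq_iff.2 ⟨g, rfl⟩ :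
          T.edgeOrbit ⟨T.translation g '' (e : Set T), he⟩ = T.edgeOrbit e).symm⟩
    | one =>
      intro e he
      exact ⟨0, congrArg T.edgeOrbit (Subtype.ext (Set.image_id _).symm)⟩
    | mul h₁ h₂ hh₁ hh₂ ih₁ ih₂ =>
      intro e he
      have he₂ := (hΓ hh₂).image_mem_edges e.2
      have he₁ := (hΓ hh₁).image_mem_edges he₂
      have h3 := (ih₂ e he₂).trans (ih₁ ⟨_, he₂⟩ he₁)
      convert h3 using 3
      exact GTree.image_mul _ _ _
    | inv h hh ih =>
      intro e he
      have h3 := ih ⟨_, he⟩ (by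
        rw [← GTree.image_mul, mul_inv_cancel]
        exact (Set.image_id (e : Set T)).symm ▸ e.2)
      convert h3.symm using 3
      exact (GTree.inv_image_image h⁻¹ e).symm
  intro q _ q' _
  obtain ⟨e, rfl⟩ := Quotient.exists_rep q
  obtain ⟨e', rfl⟩ := Quotient.exists_rep q'
  obtain ⟨hm, hc, hf, -⟩ := hT.1
  -- Invariance of `E` under both `k` and its inverse makes `k` map the union of `E` onto itself, as
  -- the collapse argument requires.
  obtain ⟨h, hh, hhe⟩ := GTree.mem_edgeSetOrbit_of_fixed_points hm hf hc hΓ htr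
    (fun E hE hinv x => GTree.exists_fixed_point hirr hT.1 hk hE (by
      have hsub : ∀ l ∈ Γ, l '' ⋃₀ E.carrier ⊆ ⋃₀ E.carrier := by
        rintro l hl _ ⟨y, ⟨d, hd, hyd⟩, rfl⟩
        exact ⟨_, hinv l hl d hd, y, hyd, rfl⟩
      refine Set.Subset.antisymm (hsub k hkΓ) ?_
      have h3 := Set.image_mono (f := k) (hsub k⁻¹ (Γ.inv_mem hkΓ))
      rwa [← GTree.image_mul, mul_inv_cancel, IsometryEquiv.coe_one, Set.image_id] at h3) x)
    e.2 e'.2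
  have h3 := hcycle h hh e (hhe ▸ e'.2)
  have h4 : (⟨h '' (e : Set T), hhe ▸ e'.2⟩ : T.edges) = e' := Subtype.ext hhe
  rw [h4] at h3
  exact h3
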